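/- Conventions. A geometry is a set $X$ of points with a family of subsets, called subspaces, such that: $\emptyset$, $X$ and all singletons are subspaces; intersections of subspaces are subspaces; for a subspace $S$ and $x\notin S$ no subspace lies strictly between $S$ and $S\vee x$; and every point of the closure $\overline A$ of $A\subseteq X$ (the least subspace containing $A$) lies in the closure of a finite subset of $A$. Here $S\vee x:=\overline{S\cup\{x\}}$. A set $A$ is independent if $a\notin\overline{A\setminus\{a\}}$ for all $a\in A$; a basis of a subspace $S$ is an independent set whose closure is $S$; the dimension of $S$ is the cardinality of a basis minus $1$; lines and planes are the subspaces of dimension $1$ and $2$. A subset $A\subseteq X$ is a geometry (a subgeometry of $X$) with the subspaces $S\cap A$, where $S$ is a subspace of $X$. A morphism of geometries is a map such that preimages of subspaces are subspaces. For $x\in X$, $X/x$ is the quotient of $X\setminus\{x\}$ by the relation $y\sim z\Leftrightarrow y\vee x=z\vee x$; if $A$ is a subgeometry of $X$ and $x\in A$, then $A/x$ is regarded as a subset of $X/x$ via $[y]\mapsto[y]$. A geometry has enough points if it has dimension $\ge 2$ and every plane contains four points, no three of which are collinear. For a (left) vector space $V$ over a division ring $K$, $\mathbb P(V)$ is the set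 of $1$-dimensional vector subspaces of $V$, a geometry whose subspaces are the $\mathbb P(W)$ for vector subspaces $W\subseteq V$. For vector spaces $V,V'$ over division rings $K,K'$, a map $\Phi:V\to V'$ is semilinear if it is additive and $\Phi(\lambda v)=\sigma(\lambda)\Phi(v)$ for some ring morphism $\sigma:K\to K'$ (not necessarily surjective) and all $\lambda\in K$, $v\in V$. It induces the partial map $\mathbb P(V)\dashrightarrow\mathbb P(V')$, $\langle v\rangle\mapsto\langle\Phi(v)\rangle$, defined exactly on the complement of $\mathbb P(\ker\Phi)$; partial maps of this form are called partial projective morphisms. Theorem. Let $V,V'$ be vector spaces over division rings $K,K'$, let $\mathbb P=\mathbb P(V)$ and $\mathbb P'=\mathbb P(V')$, let $X\subseteq\mathbb P$ be a subgeometry with enough points, and let $\varphi:X\to\mathbb P'$ be a morphism of geometries such that: 1. the image of $\varphi$ is not contained in a subspace of $\mathbb P'$ of dimension $\le 2$; 2. there exist $x_1,x_2\in X$ with $X/x_1=\mathbb P/x_1$, $X/x_2=\mathbb P/x_2$ and $\varphi(x_1)\ne\varphi(x_2)$. Then there is a unique partial projective morphism $\phi:\mathbb P\dashrightarrow\mathbb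 P'$ that is defined at every point of $X$ and satisfies $\phi|_X=\varphi$. Moreover, there is a semilinear map $\Phi:V\to V'$ inducing a partial map with this property, and any other such semilinear map is of the form $c\,\Phi$ with $c\in K'$, $c\neq 0$. -/

import Mathlib

open scoped LinearAlgebra.Projectivization

universe u v

/-- The intersection of all members of the family `F` that contain `A`. -/
def familyClosure {X : Type u} (F : Set (Set X)) (A : Set X) : Set X :=
  ⋂₀ {S | S ∈ F ∧ A ⊆ S}

/-- A geometry on a set of points `X`: a family of subsets (the subspaces, or flats)
satisfying the axioms G1 - G4. -/
structure PointGeometry (X : Type u) where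
  flats : Set (Set X)
  /-- G1 -/
  empty_mem : ∅ ∈ flats
  univ_mem : Set.univ ∈ flats
  singleton_mem : ∀ x : X, {x} ∈ flats
  /-- G2 -/
  sInter_mem : ∀ 𝓢 : Set (Set X), 𝓢 ⊆ flats → ⋂₀ 𝓢 ∈ flats
  /-- G3, the exchange axiom: there is no flat strictly between `S` and `S ∨ x`. -/
  exchange : ∀ S ∈ flats, ∀ x : X, x ∉ S →
    ¬ ∃ S' ∈ flats, S ⊂ S' ∧ S' ⊂ familyClosure flats (insert x S)
  /-- G4, the finitary axiom. -/
  finitary : ∀ (A : Set X) (x : X), x ∈ familyClosure flats A →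
    ∃ F : Set X, F.Finite ∧ F ⊆ A ∧ x ∈ familyClosure flats F

namespace PointGeometry

variable {X : Type u} {Y : Type v}

/-- The closure of a subset: the least flat containing it. -/
def closure (G : PointGeometry X) (A : Set X) : Set X := familyClosure G.flats A

theorem closure_mem (G : PointGeometry X) (A : Set X) : G.closure A ∈ G.flats :=
  G.sInter_mem _ fun _ h => h.1

theorem subset_closure (G : PointGeometry X) (A : Set X) : A ⊆ G.closure A :=
  fun _ hx _ hS => hS.2 hx

theorem closure_subset (G : PointGeometry X) {A S : Set X} (hS : S ∈ G.flats) (h : A ⊆ S) :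
    G.closure A ⊆ S :=
  fun _ hx => hx S ⟨hS, h⟩

theorem closure_mono (G : PointGeometry X) {A B : Set X} (h : A ⊆ B) :
    G.closure A ⊆ G.closure B :=
  G.closure_subset (G.closure_mem B) (h.trans (G.subset_closure B))

/-- The flats of the subgeometry on `A` are the traces `S ∩ A` of the flats `S`. -/
def traceFlats (G : PointGeometry X) (A : Set X) : Set (Set A) :=
  {T | ∃ S ∈ G.flats, T = {a : A | (a : X) ∈ S}}

theorem familyClosure_traceFlats (G : PointGeometry X) (A : Set X) (B : Set A) :
    familyClosure (G.traceFlats A) B = {a : A | (a : X) ∈ G.closure (Subtype.val '' B)} := by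
  apply Set.Subset.antisymm
  · intro a ha
    exact ha _ ⟨⟨_, G.closure_mem (Subtype.val '' B), rfl⟩,
      fun b hb => G.subset_closure _ ⟨b, hb, rfl⟩⟩
  · rintro a ha _ ⟨⟨S, hS, rfl⟩, hB⟩
    refine G.closure_subset hS ?_ ha
    rintro _ ⟨b, hb, rfl⟩
    exact hB hb

/-- The subgeometry structure on a subset `A`. -/
def subgeometry (G : PointGeometry X) (A : Set X) : PointGeometry A where
  flats := G.traceFlats A
  empty_mem := ⟨∅, G.empty_mem, by simp⟩
  univ_mem := ⟨Set.univ, G.univ_mem, by simp⟩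
  singleton_mem x := ⟨{(x : X)}, G.singleton_mem _, by ext; simp [Subtype.ext_iff]⟩
  sInter_mem 𝓢 h𝓢 := by
    refine ⟨⋂₀ {S | S ∈ G.flats ∧ {a : A | (a : X) ∈ S} ∈ 𝓢},
      G.sInter_mem _ fun S hS => hS.1, ?_⟩
    ext a
    constructor
    · intro ha S hS
      exact ha _ hS.2
    · intro ha T hT
      obtain ⟨S, hS, rfl⟩ := h𝓢 hT
      exact ha S ⟨hS, hT⟩
  exchange := by
    rintro _ ⟨S, hS, rfl⟩ x hxT ⟨_, ⟨S', hS', rfl⟩, ⟨hTT', hne⟩, hT'x, hne'⟩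
    obtain ⟨y, hyS', hyT⟩ := Set.not_subset.1 hne
    apply hne'
    rw [familyClosure_traceFlats] at hT'x ⊢
    set C := G.closure (Subtype.val '' {a : A | (a : X) ∈ S}) with hC
    have hCS : C ⊆ S := G.closure_subset hS (by rintro _ ⟨b, hb, rfl⟩; exact hb)
    have hyC : (y : X) ∉ C := fun h => hyT (hCS h)
    have hxC : (x : X) ∉ C := fun h => hxT (hCS h)
    have hCflat : C ∈ G.flats := G.closure_mem _
    have hcx : G.closure (Subtype.val '' (insert x {a : A | (a : X) ∈ S}))
        ⊆ G.closure (insert (x : X) C) := by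
      apply G.closure_mono
      rw [Set.image_insert_eq]
      exact Set.insert_subset_insert (G.subset_closure _)
    have hyx : (y : X) ∈ G.closure (insert (x : X) C) := hcx (hT'x hyS')
    have hle : G.closure (insert (y : X) C) ⊆ G.closure (insert (x : X) C) :=
      G.closure_subset (G.closure_mem _) (Set.insert_subset hyx
        ((Set.subset_insert _ _).trans (G.subset_closure _)))
    have hxy : (x : X) ∈ G.closure (insert (y : X) C) := by
      by_contra hcon
      refine G.exchange C hCflat x hxC ⟨G.closure (insert (y : X) C), G.closure_mem _,
        ⟨(Set.subset_insert _ _).trans (G.subset_closure _), fun h =>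
          hyC (h (G.subset_closure _ (Set.mem_insert _ _)))⟩, hle, fun h =>
          hcon (h (G.subset_closure _ (Set.mem_insert _ _)))⟩
    have hCS' : C ⊆ S' := G.closure_subset hS' (by rintro _ ⟨b, hb, rfl⟩; exact hTT' hb)
    have hxS' : (x : X) ∈ S' := G.closure_subset hS' (Set.insert_subset hyS' hCS') hxy
    intro a ha
    exact G.closure_subset hS' (Set.insert_subset hxS' hCS') (hcx ha)
  finitary B x hx := by
    rw [familyClosure_traceFlats] at hx
    obtain ⟨F, hF, hFB, hxF⟩ := G.finitary _ _ hx
    refine ⟨Subtype.val ⁻¹' F, hF.preimage Subtype.val_injective.injOn, ?_, ?_⟩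
    · intro a ha
      obtain ⟨b, hb, hba⟩ := hFB ha
      rwa [← Subtype.ext hba]
    · rw [familyClosure_traceFlats]
      refine G.closure_mono ?_ hxF
      intro z hz
      obtain ⟨b, hb, rfl⟩ := hFB hz
      exact ⟨b, hz, rfl⟩

/-- A subset is independent when no point lies in the closure of the others. -/
def Independent (G : PointGeometry X) (A : Set X) : Prop :=
  ∀ a ∈ A, a ∉ G.closure (A \ {a})

/-- A basis of `S` is an independent set generating `S`. -/
def IsBasis (G : PointGeometry X) (B S : Set X) : Prop :=
  G.Independent B ∧ G.closure B = S

/-- `S` is a flat of dimension `n`, i.e. it has a basis with `n + 1` elements. -/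
def HasDim (G : PointGeometry X) (S : Set X) (n : ℕ) : Prop :=
  ∃ B, G.IsBasis B S ∧ B.encard = n + 1

/-- `S` is a flat of dimension at most `n`. -/
def DimLE (G : PointGeometry X) (S : Set X) (n : ℕ) : Prop :=
  ∃ B, G.IsBasis B S ∧ B.encard ≤ n + 1

/-- `S` is a flat of (possibly infinite) dimension at least `n`. -/
def DimGE (G : PointGeometry X) (S : Set X) (n : ℕ) : Prop :=
  ∃ B, G.IsBasis B S ∧ n + 1 ≤ B.encard

def IsLine (G : PointGeometry X) (S : Set X) : Prop := G.HasDim S 1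

def IsPlane (G : PointGeometry X) (S : Set X) : Prop := G.HasDim S 2

def Collinear (G : PointGeometry X) (A : Set X) : Prop := ∃ L, G.IsLine L ∧ A ⊆ L

/-- A geometry of dimension at least `2` has enough points when every plane has four points,
no three of which are collinear. -/
def EnoughPoints (G : PointGeometry X) : Prop :=
  G.DimGE Set.univ 2 ∧
    ∀ P, G.IsPlane P → ∃ Q ⊆ P, Q.encard = 4 ∧ ∀ T ⊆ Q, T.encard = 3 → ¬ G.Collinear T

/-- A morphism of geometries: preimages of flats are flats. -/
def IsMorphism (G : PointGeometry X) (H : PointGeometry Y) (φ : X → Y) : Prop :=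
  ∀ S ∈ H.flats, φ ⁻¹' S ∈ G.flats

/-- The relation `y ∨ E = z ∨ E` on the complement of `E`. -/
def quotientSetoid (G : PointGeometry X) (E : Set X) : Setoid {y : X // y ∉ E} where
  r y z := G.closure (insert (y : X) E) = G.closure (insert (z : X) E)
  iseqv := ⟨fun _ => rfl, fun h => h.symm, fun h h' => h.trans h'⟩

/-- The set of points of the quotient geometry `X / E`. -/
def QuotientPoints (G : PointGeometry X) (E : Set X) : Type u := Quotient (G.quotientSetoid E)

/-- For a subgeometry `A` and `x ∈ A`, the natural map `A / x → X / x`, `[y] ↦ [y]`. -/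
def quotientInclusion (G : PointGeometry X) (A : Set X) (x : A) :
    (G.subgeometry A).QuotientPoints {x} → G.QuotientPoints {(x : X)} :=
  Quotient.map (fun y => ⟨((y : A) : X), fun h => y.2 (Subtype.ext h)⟩) (by
    have key : ∀ y z : A, (G.subgeometry A).closure {y, x} = (G.subgeometry A).closure {z, x} →
        G.closure {(y : X), (x : X)} ⊆ G.closure {(z : X), (x : X)} := by
      intro y z h
      have hy : y ∈ (G.subgeometry A).closure {z, x} :=
        h ▸ (G.subgeometry A).subset_closure _ (Set.mem_insert _ _)
      have hy' : y ∈ familyClosure (G.traceFlats A) {z, x} := hy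
      rw [familyClosure_traceFlats, Set.image_pair] at hy'
      refine G.closure_subset (G.closure_mem _) (Set.insert_subset hy' ?_)
      exact (Set.subset_insert _ _).trans (G.subset_closure _)
    intro y z h
    exact Set.Subset.antisymm (key _ _ h) (key _ _ (Eq.symm h)))

/-- `A / x = X / x`. As `A / x` is a subgeometry of `X / x` by means of the (injective) natural map,
the equality says that this map reaches every point. -/
def QuotientsAgree (G : PointGeometry X) (A : Set X) (x : A) : Prop :=
  Function.Surjective (G.quotientInclusion A x)

end PointGeometry

section Projective

variable (K : Type*) (V : Type*) [DivisionRing K] [AddCommGroup V] [Module K V]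

/-- The projectivizations `ℙ(W)` of the vector subspaces `W ⊆ V`. -/
def projectiveFlats : Set (Set (ℙ K V)) :=
  {S | ∃ W : Submodule K V, S = {p : ℙ K V | p.submodule ≤ W}}

theorem familyClosure_projectiveFlats (A : Set (ℙ K V)) :
    familyClosure (projectiveFlats K V) A =
      {p : ℙ K V | p.submodule ≤ Submodule.span K (Projectivization.rep '' A)} := by
  apply Set.Subset.antisymm
  · intro p hp
    refine hp _ ⟨⟨_, rfl⟩, fun a ha => ?_⟩
    rw [Set.mem_ofPred_eq, Projectivization.submodule_eq, Submodule.span_singleton_le_iff_mem]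
    exact Submodule.subset_span ⟨a, ha, rfl⟩
  · rintro p hp _ ⟨⟨W, rfl⟩, hA⟩
    refine le_trans hp (Submodule.span_le.2 ?_)
    rintro _ ⟨a, ha, rfl⟩
    have := hA ha
    rwa [Set.mem_ofPred_eq, Projectivization.submodule_eq,
      Submodule.span_singleton_le_iff_mem] at this

theorem mem_familyClosure_projectiveFlats (A : Set (ℙ K V)) (p : ℙ K V) :
    p ∈ familyClosure (projectiveFlats K V) A ↔
      p.rep ∈ Submodule.span K (Projectivization.rep '' A) := by
  rw [familyClosure_projectiveFlats, Set.mem_ofPred_eq, Projectivization.submodule_eq,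
    Submodule.span_singleton_le_iff_mem]

/-- The projective space `ℙ(V)` as a geometry. -/
def projectiveGeometry : PointGeometry (ℙ K V) where
  flats := projectiveFlats K V
  empty_mem := by
    refine ⟨⊥, Eq.symm (Set.eq_empty_of_forall_notMem fun p hp => p.rep_nonzero ?_)⟩
    rw [Set.mem_ofPred_eq, Projectivization.submodule_eq,
      Submodule.span_singleton_le_iff_mem] at hp
    simpa using hp
  univ_mem := ⟨⊤, by simp⟩
  singleton_mem x := by
    refine ⟨x.submodule, ?_⟩
    ext p
    simp only [Set.mem_singleton_iff, Set.mem_ofPred_eq]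
    refine ⟨fun h => h ▸ le_rfl, fun h => Projectivization.submodule_injective ?_⟩
    exact Submodule.eq_of_le_of_finrank_eq h (by simp [Projectivization.finrank_submodule])
  sInter_mem 𝓢 h𝓢 := by
    refine ⟨sInf {W | {p : ℙ K V | p.submodule ≤ W} ∈ 𝓢}, ?_⟩
    ext p
    rw [Set.mem_ofPred_eq, le_sInf_iff]
    constructor
    · intro hp W hW
      exact hp _ hW
    · intro hp S hS
      obtain ⟨W, rfl⟩ := h𝓢 hS
      exact hp W hS
  exchange := by
    rintro _ ⟨W, rfl⟩ x hx ⟨_, ⟨W', rfl⟩, ⟨hWW', hne⟩, hW'x, hne'⟩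
    obtain ⟨y, hyW', hyW⟩ := Set.not_subset.1 hne
    apply hne'
    have hy := hW'x hyW'
    set R := Projectivization.rep '' {p : ℙ K V | p.submodule ≤ W} with hR
    rw [mem_familyClosure_projectiveFlats, Set.image_insert_eq] at hy
    have hRW : Submodule.span K R ≤ W := by
      refine Submodule.span_le.2 ?_
      rintro _ ⟨a, ha, rfl⟩
      rwa [Set.mem_ofPred_eq, Projectivization.submodule_eq,
        Submodule.span_singleton_le_iff_mem] at ha
    have hRW' : R ⊆ W' := by
      rintro _ ⟨a, ha, rfl⟩
      have := hWW' ha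
      rwa [Set.mem_ofPred_eq, Projectivization.submodule_eq,
        Submodule.span_singleton_le_iff_mem] at this
    rw [Set.mem_ofPred_eq, Projectivization.submodule_eq,
      Submodule.span_singleton_le_iff_mem] at hyW hyW'
    have hxy := mem_span_insert_exchange hy (fun h => hyW (hRW h))
    have hxW' : x.rep ∈ W' :=
      Submodule.span_le.2 (Set.insert_subset hyW' hRW') hxy
    intro p hp
    rw [mem_familyClosure_projectiveFlats, Set.image_insert_eq] at hp
    rw [Set.mem_ofPred_eq, Projectivization.submodule_eq, Submodule.span_singleton_le_iff_mem]
    exact Submodule.span_le.2 (Set.insert_subset hxW' hRW') hp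
  finitary A x hx := by
    classical
    rw [mem_familyClosure_projectiveFlats] at hx
    obtain ⟨T, hT, hxT⟩ := Submodule.mem_span_finite_of_mem_span hx
    have hinj : Function.Injective (Projectivization.rep : ℙ K V → V) := fun p q h => by
      apply Projectivization.submodule_injective
      rw [Projectivization.submodule_eq, Projectivization.submodule_eq, h]
    refine ⟨Projectivization.rep ⁻¹' (T : Set V), T.finite_toSet.preimage hinj.injOn, ?_, ?_⟩
    · intro p hp
      obtain ⟨q, hq, hqp⟩ := hT hp
      rwa [← hinj hqp]
    · rw [mem_familyClosure_projectiveFlats]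
      refine Submodule.span_mono ?_ hxT
      intro z hz
      obtain ⟨q, -, rfl⟩ := hT hz
      exact ⟨q, hz, rfl⟩

variable {K V} {K' : Type*} {V' : Type*} [DivisionRing K'] [AddCommGroup V'] [Module K' V']

/-- The partial map `⟨v⟩ ↦ ⟨Φ v⟩` associated to a semilinear map `Φ`, defined exactly on the
complement of `ℙ(ker Φ)`. -/
def partialProjectivization {σ : K →+* K'} (Φ : V →ₛₗ[σ] V') : ℙ K V →. ℙ K' V' :=
  Projectivization.lift
    (fun v : {v : V // v ≠ 0} =>
      (⟨Φ v ≠ 0, fun h => Projectivization.mk K' (Φ v) h⟩ : Part (ℙ K' V'))) (by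
    rintro ⟨a, ha⟩ ⟨b, hb⟩ t hab
    change a = t • b at hab
    subst hab
    have ht : t ≠ 0 := left_ne_zero_of_smul ha
    refine Part.ext' ?_ ?_
    · simp [ht]
    · intro h h'
      exact (Projectivization.mk_eq_mk_iff' K' _ _ h h').2 ⟨σ t, by simp⟩)

theorem mem_partialProjectivization_mk {σ : K →+* K'} (Φ : V →ₛₗ[σ] V') (v : V) (hv : v ≠ 0)
    (q : ℙ K' V') : q ∈ partialProjectivization Φ (Projectivization.mk K v hv) ↔
      ∃ h : Φ v ≠ 0, Projectivization.mk K' (Φ v) h = q :=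
  Iff.rfl

/-- A partial projective morphism is the partial map associated to some semilinear map. -/
def IsPartialProjectiveMorphism (ϕ : ℙ K V →. ℙ K' V') : Prop :=
  ∃ (σ : K →+* K') (Φ : V →ₛₗ[σ] V'), ϕ = partialProjectivization Φ

/-- `φ : X → ℙ(V')` is the restriction of the partial map `ϕ`: at each point of `X`, `ϕ` is defined
and takes the same value as `φ`. -/
def IsRestrictionOf {X : Set (ℙ K V)} (φ : X → ℙ K' V') (ϕ : ℙ K V →. ℙ K' V') : Prop :=
  ∀ x : X, φ x ∈ ϕ x

end Projective

/-! ### Proportional vectors and proportional additive maps -/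

section Vectors

open Submodule

variable {K V K' V' : Type*} [DivisionRing K] [AddCommGroup V] [Module K V]
    [DivisionRing K'] [AddCommGroup V'] [Module K' V']

/-! Write `r x` and `f x` for vectors representing a point `x` of `X` and its image. Near `x₁` the
subgeometry is as rich as the whole space: every line of `ℙ(V)` through `x₁` contains a second point
of `X`. Projecting the target from `f x₁` therefore turns the morphism into a map defined on all of
`V`, up to scalars, with values in `V' ⧸ ⟨f x₁⟩`. As the image has dimension at least 3, this map
has three independent values, so the fundamental theorem of projective geometry for partial
morphisms (`exists_addMonoidHom`) makes it additive; this is `exists_pencil_map`. The same works at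
`x₂`.

Let `N = ⟨f x₁, f x₂⟩`. Modulo `N` the two additive maps are pointwise proportional and have two
independent values, hence differ by one constant. After rescaling one of them they agree modulo `N`.
Since `⟨f x₁⟩ ∩ ⟨f x₂⟩ = 0`, the space `V'` is the fibre product of its two quotients over `V' ⧸ N`,
and the maps glue to `Φ : V → V'` (`exists_glued_map`).

By construction `Φ (r x)` represents `f x` modulo `f x₁` and modulo `f x₂`, so it represents `f x`
itself whenever `f x` is off `N`. A point `x` sent into `N` is recovered from a plane through it:
enough points gives points of `X` other than `x` that span `x` and are sent off `N`
(`exists_semilinear_map`). Uniqueness uses the same two projections: two solutions are proportional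
modulo `f x₁` and modulo `f x₂`, with equal constants. -/

theorem mem_span_singleton_symm {u v : V} (hu : u ≠ 0) (h : u ∈ span K {v}) : v ∈ span K {u} := by
  obtain ⟨c, rfl⟩ := mem_span_singleton.1 h
  have hc : c ≠ 0 := left_ne_zero_of_smul hu
  exact mem_span_singleton.2 ⟨c⁻¹, by rw [smul_smul, inv_mul_cancel₀ hc, one_smul]⟩

theorem span_singleton_eq_of_mem {u v : V} (hu : u ≠ 0) (h : u ∈ span K {v}) :
    span K {u} = span K {v} :=
  le_antisymm ((span_singleton_le_iff_mem _ _).2 h)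
    ((span_singleton_le_iff_mem _ _).2 (mem_span_singleton_symm hu h))

theorem eq_zero_iff_of_span_singleton_eq {u v : V} (h : span K {u} = span K {v}) :
    u = 0 ↔ v = 0 := by
  rw [← span_singleton_eq_bot (R := K), h, span_singleton_eq_bot]

theorem mem_span_pair_exchange {u v w : V} (h : u ∈ span K {v, w}) (hu : u ∉ span K {w}) :
    v ∈ span K {u, w} :=
  mem_span_insert_exchange h hu

theorem linearIndependent_triple_iff {a b c : V} :
    LinearIndependent K ![a, b, c] ↔
      ∀ s t r : K, s • a + t • b + r • c = 0 → s = 0 ∧ t = 0 ∧ r = 0 := by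
  rw [Fintype.linearIndependent_iff]
  constructor
  · intro h s t r hs
    have := h ![s, t, r] (by simpa [Fin.sum_univ_three] using hs)
    exact ⟨this 0, this 1, this 2⟩
  · intro h g hg i
    have := h (g 0) (g 1) (g 2) (by simpa [Fin.sum_univ_three] using hg)
    fin_cases i
    exacts [this.1, this.2.1, this.2.2]

theorem linearIndependent_triple_of_notMem {a b c : V} (hc : c ≠ 0) (hb : b ∉ span K {c})
    (ha : a ∉ span K {b, c}) : LinearIndependent K ![a, b, c] := by
  rw [linearIndependent_triple_iff]
  intro s t r h
  have hs : s = 0 := by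
    by_contra hs
    refine ha (mem_span_pair.2 ⟨s⁻¹ * (-t), s⁻¹ * (-r), ?_⟩)
    have : s • a = (-t) • b + (-r) • c := by
      rw [neg_smul, neg_smul, eq_comm, ← sub_eq_zero, ← neg_eq_zero, ← h]; abel
    rw [mul_smul, mul_smul, ← smul_add, ← this, smul_smul, inv_mul_cancel₀ hs, one_smul]
  subst hs
  rw [zero_smul, zero_add] at h
  have ht : t = 0 := by
    by_contra ht
    refine hb (mem_span_singleton.2 ⟨t⁻¹ * (-r), ?_⟩)
    have : t • b = (-r) • c := by
      rw [neg_smul, eq_neg_iff_add_eq_zero, h]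
    rw [mul_smul, ← this, smul_smul, inv_mul_cancel₀ ht, one_smul]
  subst ht
  rw [zero_smul, zero_add] at h
  exact ⟨rfl, rfl, (smul_eq_zero.1 h).resolve_right hc⟩

/-- Two additive maps whose values are proportional pointwise are globally proportional, when the
first one has two linearly independent values. -/
theorem AddMonoidHom.exists_smul_eq_of_mem_span (f h : V →+ V')
    (hfh : ∀ v, h v ∈ span K' {f v})
    {a b : V} (hab : LinearIndependent K' ![f a, f b]) : ∃ c : K', ∀ v, h v = c • f v := by
  -- The factors at `v` and `w` both equal the factor at `v + w`, by independence.
  have key : ∀ v w, LinearIndependent K' ![f v, f w] → ∀ c d : K', h v = c • f v → h w = d • f w →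
      c = d := by
    intro v w hvw c d hc hd
    obtain ⟨e, he⟩ := mem_span_singleton.1 (hfh (v + w))
    rw [map_add, map_add, hc, hd, smul_add] at he
    have := LinearIndependent.pair_iff.1 hvw (e - c) (e - d) (by
      rw [sub_smul, sub_smul, sub_add_sub_comm, he, sub_self])
    rw [← sub_eq_zero.1 this.1, ← sub_eq_zero.1 this.2]
  obtain ⟨c, hc⟩ := mem_span_singleton.1 (hfh a)
  obtain ⟨d, hd⟩ := mem_span_singleton.1 (hfh b)
  obtain rfl := key a b hab c d hc.symm hd.symm
  refine ⟨c, fun v => ?_⟩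
  obtain ⟨e, he⟩ := mem_span_singleton.1 (hfh v)
  by_cases hv : f v = 0
  · rw [← he, hv, smul_zero, smul_zero]
  by_cases hav : LinearIndependent K' ![f v, f a]
  · rw [key v a hav e c he.symm hc.symm] at he
    exact he.symm
  by_cases hbv : LinearIndependent K' ![f v, f b]
  · rw [key v b hbv e c he.symm hd.symm] at he
    exact he.symm
  -- The nonzero vector `f v` would be proportional to both `f a` and `f b`, which are independent.
  exfalso
  have aux : ∀ u : V', ¬ LinearIndependent K' ![f v, u] → u ∈ span K' {f v} := by
    intro u hu
    rw [LinearIndependent.pair_iff' hv] at hu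
    push Not at hu
    exact mem_span_singleton.2 hu
  obtain ⟨s, hs⟩ := mem_span_singleton.1 (aux _ hav)
  obtain ⟨t, ht⟩ := mem_span_singleton.1 (aux _ hbv)
  have hb0 : f b ≠ 0 := hab.ne_zero 1
  have ha0 : f a ≠ 0 := hab.ne_zero 0
  have ht0 : s ≠ 0 := by rintro rfl; exact ha0 (by rw [← hs, zero_smul])
  refine (LinearIndependent.pair_iff' ha0).1 hab (t * s⁻¹) ?_
  rw [← hs, ← ht, smul_smul, mul_assoc, inv_mul_cancel₀ ht0, mul_one]

/-- The vectors `γ v` represent the values of a partial morphism of projective spaces, with `γ v = 0`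
where it is not defined. -/
structure RepresentsMorphism (K : Type*) {V : Type*} (K' : Type*) {V' : Type*} [DivisionRing K]
    [AddCommGroup V] [Module K V] [DivisionRing K'] [AddCommGroup V'] [Module K' V']
    (γ : V → V') : Prop where
  smul_mem : ∀ (c : K) (v : V), γ (c • v) ∈ span K' {γ v}
  add_mem : ∀ v w : V, γ (v + w) ∈ span K' {γ v, γ w}

/-! ### Normalised representatives of a partial morphism -/

namespace RepresentsMorphism

variable {γ : V → V'}

theorem left_mem (hγ : RepresentsMorphism K K' γ) (v w : V) : γ v ∈ span K' {γ (v + w), γ w} := by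
  have h1 := hγ.add_mem (v + w) (-w)
  rw [add_neg_cancel_right] at h1
  have h2 := hγ.smul_mem (-1) w
  rw [neg_one_smul] at h2
  refine span_le.2 ?_ h1
  rintro _ (rfl | rfl)
  · exact subset_span (by simp)
  · exact span_mono (by simp) h2

theorem right_mem (hγ : RepresentsMorphism K K' γ) (v w : V) : γ w ∈ span K' {γ (v + w), γ v} := by
  rw [add_comm v w]
  exact hγ.left_mem w v

/-- Once a representative `a'` of `γ a` is fixed, the third point `γ (a + v)` on the line through `γ
a` and `γ v` normalises the representative of `γ v`. Both coefficients of `γ (a + v)` are nonzero,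
since otherwise `γ a` and `γ v` would fail to be independent. -/
theorem exists_compatible (hγ : RepresentsMorphism K K' γ) {a v : V} {a' : V'}
    (ha : span K' {a'} = span K' {γ a}) (ha' : a' ∉ span K' {γ v}) (hv : γ v ≠ 0) :
    ∃ u, span K' {u} = span K' {γ v} ∧ a' + u ∈ span K' {γ (a + v)} := by
  have hav : γ a ∉ span K' {γ v} := fun h => ha' ((span_singleton_le_iff_mem _ _).1
    (ha.trans_le ((span_singleton_le_iff_mem _ _).2 h)))
  have h := hγ.add_mem a v
  rw [span_insert, ← ha, ← span_insert] at h
  obtain ⟨s, t, hst⟩ := mem_span_pair.1 h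
  have hs : s ≠ 0 := by
    rintro rfl
    rw [zero_smul, zero_add] at hst
    refine hav (span_le.2 ?_ (hγ.left_mem a v))
    rintro _ (rfl | rfl)
    · exact mem_span_singleton.2 ⟨t, hst⟩
    · exact mem_span_singleton_self _
  have ht : t ≠ 0 := by
    rintro rfl
    rw [zero_smul, add_zero] at hst
    have hva : γ v ∈ span K' {γ a} := by
      refine span_le.2 ?_ (hγ.right_mem a v)
      rintro _ (rfl | rfl)
      · rw [← ha]; exact mem_span_singleton.2 ⟨s, hst⟩
      · exact mem_span_singleton_self _
    exact hav (mem_span_singleton_symm hv hva)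
  refine ⟨(s⁻¹ * t) • γ v, ?_, ?_⟩
  · exact span_singleton_smul_eq (IsUnit.mk0 _ (mul_ne_zero (inv_ne_zero hs) ht)) _
  · refine mem_span_singleton.2 ⟨s⁻¹, ?_⟩
    rw [← hst, smul_add, smul_smul, smul_smul, inv_mul_cancel₀ hs, one_smul]

/-- The difference of two candidates lies on both `γ v` and `γ (a + v)`. If it were nonzero these
would be the same point, which would then contain `a'`. -/
theorem compatible_unique {γ : V → V'} {a v : V} {a' u u₂ : V'}
    (ha' : a' ∉ span K' {γ v})
    (hu : u ∈ span K' {γ v}) (hu₂ : u₂ ∈ span K' {γ v})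
    (h : a' + u ∈ span K' {γ (a + v)}) (h₂ : a' + u₂ ∈ span K' {γ (a + v)}) : u = u₂ := by
  by_contra hne
  have hd : u - u₂ ∈ span K' {γ (a + v)} := by simpa using sub_mem h h₂
  have hd' : u - u₂ ∈ span K' {γ v} := sub_mem hu hu₂
  have heq := (span_singleton_eq_of_mem (sub_ne_zero.2 hne) hd).symm.trans
    (span_singleton_eq_of_mem (sub_ne_zero.2 hne) hd')
  have := sub_mem (heq ▸ h) hu
  rw [add_sub_cancel_right] at this
  exact ha' this

/-- Two intersections of coplanar lines. The point `γ (a + v + w)` is where the line joining `γ (a +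
v)` to `γ w` meets the one joining `γ (a + w)` to `γ v`, namely `a' + v' + w'`. Then `γ (v + w)` is
where the line joining that point to `a'` meets the line through `v'` and `w'`. The work lies in
showing that neither value is zero. -/
theorem compatible_add (hγ : RepresentsMorphism K K' γ) {a v w : V} {a' v' w' : V'}
    (hi : LinearIndependent K' ![a', v', w'])
    (ha : span K' {a'} = span K' {γ a}) (hv : span K' {v'} = span K' {γ v})
    (hw : span K' {w'} = span K' {γ w})
    (hav : a' + v' ∈ span K' {γ (a + v)}) (haw : a' + w' ∈ span K' {γ (a + w)}) :
    a' + (v' + w') ∈ span K' {γ (a + (v + w))} ∧ v' + w' ∈ span K' {γ (v + w)} := by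
  rw [linearIndependent_triple_iff] at hi
  have hne : a' + v' ≠ 0 := fun h => one_ne_zero (hi 1 1 0 (by simpa using h)).1
  have hne' : a' + w' ≠ 0 := fun h => one_ne_zero (hi 1 0 1 (by simpa using h)).1
  have hav' := span_singleton_eq_of_mem hne hav
  have haw' := span_singleton_eq_of_mem hne' haw
  have hvw : γ (v + w) ∈ span K' {v', w'} := by
    have := hγ.add_mem v w
    rwa [span_insert, ← hv, ← hw, ← span_insert] at this
  have h1 : γ (a + (v + w)) ∈ span K' {a' + v', w'} := by
    have := hγ.add_mem (a + v) w
    rwa [span_insert, ← hav', ← hw, ← span_insert, add_assoc] at this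
  have h2 : γ (a + (v + w)) ∈ span K' {a' + w', v'} := by
    have := hγ.add_mem (a + w) v
    rwa [span_insert, ← haw', ← hv, ← span_insert, add_assoc, add_comm w] at this
  obtain ⟨s, t, hst⟩ := mem_span_pair.1 h1
  obtain ⟨s₂, t₂, hst₂⟩ := mem_span_pair.1 h2
  -- Comparison of the coefficients of `a'`, `v'` and `w'` in the two expressions.
  obtain ⟨e1, e2, e3⟩ := hi (s - s₂) (s - t₂) (t - s₂) (by
    rw [← sub_eq_zero.2 (hst.trans hst₂.symm)]; simp only [sub_smul, smul_add]; abel)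
  have hts : t = s := by rw [sub_eq_zero.1 e1, sub_eq_zero.1 e3]
  subst hts
  have hst' : t • (a' + (v' + w')) = γ (a + (v + w)) := by rw [← hst, ← smul_add, add_assoc]
  have ht : t ≠ 0 := by
    rintro rfl
    have ha2 : γ a ∈ span K' {v', w'} := by
      refine span_le.2 ?_ (hγ.left_mem a (v + w))
      rintro _ (rfl | rfl)
      · rw [← hst', zero_smul]; exact zero_mem _
      · exact hvw
    have ha3 : a' ∈ span K' {v', w'} :=
      (span_singleton_le_iff_mem _ _).1 (ha.trans_le ((span_singleton_le_iff_mem _ _).2 ha2))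
    obtain ⟨p, q, hpq⟩ := mem_span_pair.1 ha3
    exact one_ne_zero (hi 1 (-p) (-q) (by rw [← hpq]; simp only [smul_add, neg_smul, one_smul]; abel)).1
  have hmem : a' + (v' + w') ∈ span K' {γ (a + (v + w))} :=
    mem_span_singleton.2 ⟨t⁻¹, by rw [← hst', smul_smul, inv_mul_cancel₀ ht, one_smul]⟩
  refine ⟨hmem, ?_⟩
  obtain ⟨p, q, hpq⟩ := mem_span_pair.1 hvw
  have h3 : γ (v + w) ∈ span K' {a' + (v' + w'), a'} := by
    have := hγ.right_mem a (v + w)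
    rw [← hst'] at this
    refine span_le.2 ?_ this
    rintro _ (rfl | rfl)
    · exact Submodule.smul_mem _ _ (subset_span (by simp))
    · have : γ a ∈ span K' {a'} := ha ▸ mem_span_singleton_self _
      exact span_mono (by simp) this
  obtain ⟨l, m, hlm⟩ := mem_span_pair.1 h3
  obtain ⟨e1, e2, e3⟩ := hi (l + m) (l - p) (l - q) (by
    rw [← sub_eq_zero.2 (hlm.trans hpq.symm)]; simp only [sub_smul, add_smul, smul_add]; abel)
  have hqp : q = p := by rw [← sub_eq_zero.1 e2, ← sub_eq_zero.1 e3]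
  subst hqp
  have hpq' : q • (v' + w') = γ (v + w) := by rw [← hpq, smul_add]
  have hq : q ≠ 0 := by
    rintro rfl
    have hv2 : γ v ∈ span K' {w'} := by
      refine span_le.2 ?_ (hγ.left_mem v w)
      rintro _ (rfl | rfl)
      · rw [← hpq', zero_smul]; exact zero_mem _
      · rw [hw]; exact mem_span_singleton_self _
    have hv3 : v' ∈ span K' {w'} :=
      (span_singleton_le_iff_mem _ _).1 (hv.trans_le ((span_singleton_le_iff_mem _ _).2 hv2))
    obtain ⟨p, hp⟩ := mem_span_singleton.1 hv3
    exact one_ne_zero (hi 0 1 (-p) (by rw [← hp]; simp only [neg_smul, one_smul, zero_smul]; abel)).2.1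
  exact mem_span_singleton.2 ⟨q⁻¹, by rw [← hpq', smul_smul, inv_mul_cancel₀ hq, one_smul]⟩

end RepresentsMorphism

end Vectors

/-! ### The fundamental theorem for partial morphisms -/

section Vectors

open Submodule

variable {K V K' V' : Type*} [DivisionRing K] [AddCommGroup V] [Module K V]
    [DivisionRing K'] [AddCommGroup V'] [Module K' V']

theorem exists_notMem_span_pair {e : Fin 3 → V} (he : LinearIndependent K e) (u v : V) :
    ∃ i, e i ∉ span K {u, v} := by
  classical
  by_contra! h
  have h1 : span K (Set.range e) ≤ span K {u, v} := span_le.2 (by rintro _ ⟨i, rfl⟩; exact h i)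
  have : FiniteDimensional K (span K ({u, v} : Set V)) :=
    FiniteDimensional.span_of_finite K (Set.toFinite _)
  have h2 := Submodule.finrank_mono h1
  rw [finrank_span_eq_card he] at h2
  have h3 : Module.finrank K (span K ({u, v} : Set V)) ≤ 2 := by
    have := finrank_span_finset_le_card (R := K) ({u, v} : Finset V)
    simp only [Finset.coe_insert, Finset.coe_singleton] at this
    exact this.trans Finset.card_le_two
  simp at h2
  omega

namespace RepresentsMorphism

variable {γ : V → V'}

/-- Normalising `b` and `c` against `a` already makes them compatible with each other, by
`compatible_add`. The resulting symmetric frame is the reference for all other vectors: any two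
values of `γ` leave at least one frame vector outside their span. -/
theorem exists_compatible_triple (hγ : RepresentsMorphism K K' γ) {a b c : V}
    (hi : LinearIndependent K' ![γ a, γ b, γ c]) :
    ∃ (e : Fin 3 → V) (e' : Fin 3 → V'), LinearIndependent K' e' ∧
      (∀ i, span K' {e' i} = span K' {γ (e i)}) ∧
      ∀ i j, i ≠ j → e' i + e' j ∈ span K' {γ (e i + e j)} := by
  have hi' := linearIndependent_triple_iff.1 hi
  have hab : γ a ∉ span K' {γ b} := fun h => by
    obtain ⟨t, ht⟩ := mem_span_singleton.1 h
    exact one_ne_zero (hi' 1 (-t) 0 (by rw [← ht]; simp)).1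
  have hac : γ a ∉ span K' {γ c} := fun h => by
    obtain ⟨t, ht⟩ := mem_span_singleton.1 h
    exact one_ne_zero (hi' 1 0 (-t) (by rw [← ht]; simp)).1
  obtain ⟨b', hb', hab'⟩ := hγ.exists_compatible rfl hab (hi.ne_zero 1)
  obtain ⟨c', hc', hac'⟩ := hγ.exists_compatible rfl hac (hi.ne_zero 2)
  have hb0 : b' ≠ 0 := fun h => hi.ne_zero 1 ((eq_zero_iff_of_span_singleton_eq hb').1 h)
  have hc0 : c' ≠ 0 := fun h => hi.ne_zero 2 ((eq_zero_iff_of_span_singleton_eq hc').1 h)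
  have hind : LinearIndependent K' ![γ a, b', c'] := by
    refine linearIndependent_triple_of_notMem hc0 ?_ ?_
    · intro h
      have : γ b ∈ span K' {γ c} := by
        rw [← span_singleton_le_iff_mem, ← hb', ← hc', span_singleton_le_iff_mem]; exact h
      obtain ⟨t, ht⟩ := mem_span_singleton.1 this
      exact one_ne_zero (hi' 0 1 (-t) (by rw [← ht]; simp)).2.1
    · intro h
      rw [span_insert, hb', hc', ← span_insert] at h
      obtain ⟨s, t, hst⟩ := mem_span_pair.1 h
      exact one_ne_zero (hi' 1 (-s) (-t) (by
        rw [← hst]; simp only [one_smul, neg_smul]; abel)).1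
  have hbc := (hγ.compatible_add hind rfl hb' hc' hab' hac').2
  refine ⟨![a, b, c], ![γ a, b', c'], hind, ?_, ?_⟩
  · intro i
    fin_cases i
    exacts [rfl, hb', hc']
  · intro i j hij
    fin_cases i <;> fin_cases j <;> first | exact absurd rfl hij | skip
    · exact hab'
    · exact hac'
    · change b' + γ a ∈ span K' {γ (b + a)}
      rw [add_comm b', add_comm b]; exact hab'
    · exact hbc
    · change c' + γ a ∈ span K' {γ (c + a)}
      rw [add_comm c', add_comm c]; exact hac'
    · change c' + b' ∈ span K' {γ (c + b)}
      rw [add_comm c', add_comm c]; exact hbc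

/-- Normalise against one frame vector off `γ v`; `compatible_add` transfers the normalisation to
another frame vector whenever the two and `u` are independent. -/
theorem exists_lift (hγ : RepresentsMorphism K K' γ) {e : Fin 3 → V} {e' : Fin 3 → V'}
    (he : LinearIndependent K' e') (hs : ∀ i, span K' {e' i} = span K' {γ (e i)})
    (hc : ∀ i j, i ≠ j → e' i + e' j ∈ span K' {γ (e i + e j)}) (v : V) :
    ∃ u, span K' {u} = span K' {γ v} ∧
      ∀ i, e' i ∉ span K' {γ v} → e' i + u ∈ span K' {γ (e i + v)} := by
  by_cases hv : γ v = 0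
  · refine ⟨0, by rw [hv], fun i _ => ?_⟩
    have h := hγ.left_mem (e i) v
    rw [hv, Set.pair_comm, span_insert_zero] at h
    rw [add_zero, ← span_singleton_le_iff_mem, hs, span_singleton_le_iff_mem]
    exact h
  obtain ⟨i, hi⟩ := exists_notMem_span_pair he (γ v) (γ v)
  rw [Set.pair_eq_singleton] at hi
  obtain ⟨u, hu, hiu⟩ := hγ.exists_compatible (hs i) hi hv
  have hu0 : u ≠ 0 := fun h => hv ((eq_zero_iff_of_span_singleton_eq hu).1 h)
  have step : ∀ k l, k ≠ l → e' k ∉ span K' {γ v} → e' k + u ∈ span K' {γ (e k + v)} →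
      e' l ∉ span K' {γ v} → e' k ∉ span K' {e' l, u} → e' l + u ∈ span K' {γ (e l + v)} := by
    intro k l hkl hk hku hl hkl'
    rw [← hu] at hl
    exact (hγ.compatible_add (linearIndependent_triple_of_notMem hu0 hl hkl') (hs k) (hs l) hu
      (hc k l hkl) hku).2
  refine ⟨u, hu, fun j hj => ?_⟩
  by_cases hij : i = j
  · exact hij ▸ hiu
  by_cases hmem : e' i ∈ span K' {e' j, u}
  -- Here `u` lies on the line through `e' i` and `e' j`, so no direct transfer is possible. The
  -- third frame vector is off that line, and the transfer goes through it in two steps.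
  · obtain ⟨k, hki, hkj⟩ : ∃ k : Fin 3, k ≠ i ∧ k ≠ j := by
      have : ∀ i j : Fin 3, ∃ k : Fin 3, k ≠ i ∧ k ≠ j := by decide
      exact this i j
    have hu' : u ∈ span K' {e' i, e' j} := by
      rw [Set.pair_comm] at hmem
      have := mem_span_pair_exchange hmem (fun h => he.notMem_span_image (s := {j}) (x := i)
        (by simpa using hij) (by simpa using h))
      exact this
    have hk : e' k ∉ span K' {e' i, e' j} := fun h =>
      he.notMem_span_image (s := {i, j}) (x := k) (by simp [hki, hkj])
        (by simpa [Set.image_pair] using h)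
    have hkv : e' k ∉ span K' {γ v} := by
      rw [← hu]
      exact fun h => hk ((span_singleton_le_iff_mem _ _).2 hu' h)
    have hku : e' k + u ∈ span K' {γ (e k + v)} := by
      refine step i k hki.symm hi hiu hkv fun h => hk ?_
      have hiu' : e' i ∉ span K' {u} := by rw [hu]; exact hi
      have := mem_span_pair_exchange h hiu'
      refine span_le.2 ?_ this
      rintro _ (rfl | rfl)
      · exact subset_span (by simp)
      · exact hu'
    refine step k j hkj hkv hku hj fun h => hk ?_
    refine span_le.2 ?_ h
    rintro _ (rfl | rfl)
    · exact subset_span (by simp)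
    · exact hu'
  · exact step i j hij hi hiu hj hmem

/-- The fundamental theorem of projective geometry, for partial morphisms: a partial morphism with
three independent values is induced by an additive map. -/
theorem exists_addMonoidHom (hγ : RepresentsMorphism K K' γ) {a b c : V}
    (hi : LinearIndependent K' ![γ a, γ b, γ c]) :
    ∃ f : V →+ V', ∀ v, span K' {f v} = span K' {γ v} := by
  obtain ⟨e, e', he, hs, hc⟩ := hγ.exists_compatible_triple hi
  choose f hf hfe using hγ.exists_lift he hs hc
  have hmem : ∀ v, f v ∈ span K' {γ v} := fun v => hf v ▸ mem_span_singleton_self _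
  have huniq : ∀ v u i, e' i ∉ span K' {γ v} → u ∈ span K' {γ v} →
      e' i + u ∈ span K' {γ (e i + v)} → f v = u := fun v u i hi hu hiu =>
    compatible_unique hi (hmem v) hu (hfe v i hi) hiu
  have hzero : ∀ v, γ v = 0 → f v = 0 := fun v hv => by
    have := hmem v
    rwa [hv, span_singleton_eq_bot.2 rfl, mem_bot] at this
  have hker : ∀ v w, γ v = 0 → span K' {γ (v + w)} = span K' {γ w} := by
    intro v w hv
    apply le_antisymm <;> rw [span_singleton_le_iff_mem]
    · have := hγ.add_mem v w
      rwa [hv, span_insert_zero] at this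
    · have := hγ.right_mem v w
      rwa [hv, Set.pair_comm, span_insert_zero] at this
  have addker : ∀ v w, γ v = 0 → f (v + w) = f w := by
    intro v w hv
    obtain ⟨i, hi⟩ := exists_notMem_span_pair he (γ w) (γ w)
    rw [Set.pair_eq_singleton] at hi
    refine huniq _ _ i (by rwa [hker v w hv]) (by rw [hker v w hv]; exact hmem w) ?_
    rw [add_left_comm, hker v (e i + w) hv]
    exact hfe w i hi
  -- With a frame vector off the span of `γ v` and `γ w`, the sum `f w + f v` satisfies the
  -- normalisation that characterises `f (w + v)`.
  have addind : ∀ v w, γ w ∉ span K' {γ v} → f (v + w) = f v + f w := by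
    intro v w hvw
    by_cases hv : γ v = 0
    · rw [addker v w hv, hzero v hv, zero_add]
    obtain ⟨i, hi⟩ := exists_notMem_span_pair he (γ v) (γ w)
    have hi' := hi
    rw [span_insert, ← hf v, ← hf w, ← span_insert, Set.pair_comm] at hi'
    have hfv : f v ≠ 0 := fun h => hv ((eq_zero_iff_of_span_singleton_eq (hf v)).1 h)
    have hfw : f w ∉ span K' {f v} := by
      rwa [hf v, ← span_singleton_le_iff_mem, hf w, span_singleton_le_iff_mem]
    have hind := linearIndependent_triple_of_notMem hfv hfw hi'
    have h := hγ.compatible_add hind (hs i) (hf w) (hf v)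
      (hfe w i fun h => hi (span_mono (by simp) h)) (hfe v i fun h => hi (span_mono (by simp) h))
    rw [add_comm v, add_comm (f v)]
    refine huniq _ _ i (fun h => hi ?_) h.2 h.1
    rw [add_comm] at h
    exact (span_singleton_le_iff_mem _ _).2 (hγ.add_mem v w) h
  refine ⟨AddMonoidHom.mk' f fun v w => ?_, hf⟩
  by_cases hv : γ v = 0
  · rw [addker v w hv, hzero v hv, zero_add]
  by_cases hw : γ w = 0
  · rw [add_comm, addker w v hw, hzero w hw, add_zero]
  -- Now `γ v` and `γ w` may be proportional. Adding an auxiliary `e i` off their span makes each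
  -- sum below an independent one; associativity and cancellation give additivity.
  obtain ⟨i, hi⟩ := exists_notMem_span_pair he (γ v) (γ w)
  have hi' : γ (e i) ∉ span K' {γ v, γ w} := fun h => hi
    ((span_singleton_le_iff_mem _ _).1 ((hs i).trans_le ((span_singleton_le_iff_mem _ _).2 h)))
  have h1 : f (v + w + e i) = f (v + w) + f (e i) := addind _ _ fun h => hi'
    ((span_singleton_le_iff_mem _ _).2 (hγ.add_mem v w) h)
  have h2 : f (w + e i) = f w + f (e i) := addind _ _ fun h => hi' (span_mono (by simp) h)
  have h3 : f (v + (w + e i)) = f v + f (w + e i) := by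
    refine addind _ _ fun h => hi' ?_
    refine span_le.2 ?_ (hγ.right_mem w (e i))
    rintro _ (rfl | rfl)
    · exact span_mono (by simp) h
    · exact subset_span (by simp)
  rw [← add_assoc, h1, h2, ← add_assoc] at h3
  exact add_right_cancel h3

end RepresentsMorphism

end Vectors

/-! ### Scalars, projection from a point, and fibre products of quotients -/

section Vectors

open Submodule

variable {K V K' V' : Type*} [DivisionRing K] [AddCommGroup V] [Module K V]
    [DivisionRing K'] [AddCommGroup V'] [Module K' V']

theorem linearIndependent_of_span_singleton_eq {ι : Type*} {v w : ι → V}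
    (h : ∀ i, span K {v i} = span K {w i}) (hv : LinearIndependent K v) :
    LinearIndependent K w := by
  have : ∀ i, ∃ c : Kˣ, c • v i = w i := by
    intro i
    have hw : w i ∈ span K {v i} := h i ▸ mem_span_singleton_self _
    obtain ⟨c, hc⟩ := mem_span_singleton.1 hw
    have hc0 : c ≠ 0 := by
      rintro rfl
      rw [zero_smul] at hc
      exact hv.ne_zero i ((eq_zero_iff_of_span_singleton_eq (h i)).2 hc.symm)
    exact ⟨Units.mk0 c hc0, hc⟩
  choose c hc using this
  have := hv.units_smul c
  convert this using 1
  funext i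
  exact (hc i).symm

/-- Each homothety of the source is carried to a homothety of the target. -/
def ScalarCompatible (K : Type*) {V : Type*} (K' : Type*) {V' : Type*} [DivisionRing K]
    [AddCommGroup V] [Module K V] [DivisionRing K'] [AddCommGroup V'] [Module K' V']
    (F : V →+ V') : Prop :=
  ∀ l : K, ∃ c : K', ∀ v, F (l • v) = c • F v

namespace ScalarCompatible

/-- Applied to `F` and `v ↦ F (l • v)`, the proportionality lemma makes the factor independent of
`v`. -/
theorem of_mem_span {F : V →+ V'} (hF : ∀ (l : K) v, F (l • v) ∈ span K' {F v}) {a b : V}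
    (hab : LinearIndependent K' ![F a, F b]) : ScalarCompatible K K' F := fun l =>
  AddMonoidHom.exists_smul_eq_of_mem_span F
    (F.comp (DistribSMul.toAddMonoidHom V l)) (hF l) hab

theorem smul_mem {F : V →+ V'} (hF : ScalarCompatible K K' F) (l : K) (v : V) :
    F (l • v) ∈ span K' {F v} := by
  obtain ⟨c, hc⟩ := hF l
  exact mem_span_singleton.2 ⟨c, (hc v).symm⟩

theorem mem_span_smul {F : V →+ V'} (hF : ScalarCompatible K K' F) {l : K} (hl : l ≠ 0) (v : V) :
    F v ∈ span K' {F (l • v)} := by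
  have := hF.smul_mem l⁻¹ (l • v)
  rwa [smul_smul, inv_mul_cancel₀ hl, one_smul] at this

/-- The factor attached to `l` is determined by its effect on `F a ≠ 0`, which forces it to be
additive and multiplicative in `l`. -/
theorem exists_ringHom {F : V →+ V'} (hF : ScalarCompatible K K' F) {a : V} (ha : F a ≠ 0) :
    ∃ (σ : K →+* K') (Φ : V →ₛₗ[σ] V'), ∀ v, Φ v = F v := by
  choose σ hσ using hF
  have inj : ∀ c d : K', c • F a = d • F a → c = d := fun c d h => smul_left_injective K' ha h
  refine ⟨⟨⟨⟨σ, inj _ _ ?_⟩, fun l m => inj _ _ ?_⟩, inj _ _ ?_, fun l m => inj _ _ ?_⟩,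
    ⟨⟨F, map_add F⟩, fun l v => hσ l v⟩, fun v => rfl⟩
  · rw [← hσ, one_smul, one_smul]
  · change σ (l * m) • F a = (σ l * σ m) • F a
    rw [← hσ, mul_smul, hσ, hσ, mul_smul]
  · change σ 0 • F a = (0 : K') • F a
    rw [← hσ, zero_smul, zero_smul, map_zero]
  · change σ (l + m) • F a = (σ l + σ m) • F a
    rw [← hσ, add_smul, map_add, hσ, hσ, add_smul]

end ScalarCompatible

variable {ι : Type*} {r : ι → V} {f : ι → V'}

theorem mkQ_mem_span_of_mem_span (hM : ∀ (A : Set ι) y, r y ∈ span K (r '' A) → f y ∈ span K' (f '' A))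
    (x₀ : ι) {A : Set ι} {y : ι} (hy : r y ∈ span K (r '' insert x₀ A)) :
    (span K' {f x₀}).mkQ (f y) ∈ span K' ((fun z => (span K' {f x₀}).mkQ (f z)) '' A) := by
  have h := mem_map_of_mem (f := (span K' {f x₀}).mkQ) (hM _ _ hy)
  have h0 : (span K' {f x₀}).mkQ (f x₀) = 0 := by
    simp
  rwa [map_span, ← Set.image_comp, Set.image_insert_eq, Function.comp_apply, h0,
    span_insert_zero] at h

/-- Send `v` to the class of `f y`, where `y` is a point indexed by `ι` on the line joining `v` to
`r x₀`. Modulo `f x₀` the choice of `y` matters only up to a scalar, and the result is a partial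
morphism on all of `V`. -/
theorem exists_pencil_map (hM : ∀ (A : Set ι) y, r y ∈ span K (r '' A) → f y ∈ span K' (f '' A))
    (x₀ : ι)
    (hQ : ∀ v ∉ span K {r x₀}, ∃ y, r y ∉ span K {r x₀} ∧ v ∈ span K {r y, r x₀})
    {a b c : ι} (habc : LinearIndependent K' ![(span K' {f x₀}).mkQ (f a),
      (span K' {f x₀}).mkQ (f b), (span K' {f x₀}).mkQ (f c)]) :
    ∃ F : V →+ V' ⧸ span K' {f x₀}, ScalarCompatible K K' F ∧
      ∀ y, span K' {F (r y)} = span K' {(span K' {f x₀}).mkQ (f y)} := by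
  set π := (span K' {f x₀}).mkQ with hπ
  -- The set `A` is `{y}`, or empty when `v` lies on `r x₀` and the value is 0. It records that `v`
  -- is spanned by indexed points whose classes lie on `g`; the last clause records that `g` itself
  -- comes from such a point. The two directions are used separately below.
  have hex : ∀ v, ∃ g : V' ⧸ span K' {f x₀}, ∃ A : Set ι, v ∈ span K (r '' insert x₀ A) ∧
      (∀ y ∈ A, π (f y) ∈ span K' {g}) ∧
      (g = 0 ∨ ∃ y, r y ∈ span K {v, r x₀} ∧ g = π (f y)) := by
    intro v
    by_cases hv : v ∈ span K {r x₀}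
    · exact ⟨0, ∅, by simpa using hv, by simp, Or.inl rfl⟩
    · obtain ⟨y, hy, hvy⟩ := hQ v hv
      refine ⟨π (f y), {y}, ?_, ?_, Or.inr ⟨y, mem_span_pair_exchange hvy hv, rfl⟩⟩
      · rwa [Set.image_pair, Set.pair_comm]
      · rintro _ rfl
        exact mem_span_singleton_self _
  choose γ A hA hAγ hγ using hex
  have star : ∀ (T : Set V) y, r y ∈ span K (insert (r x₀) T) → π (f y) ∈ span K' (γ '' T) := by
    intro T y hy
    have h1 : r y ∈ span K (r '' insert x₀ (⋃ t ∈ T, A t)) := by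
      refine span_le.2 ?_ hy
      refine Set.insert_subset (subset_span ⟨x₀, by simp, rfl⟩) fun t ht => ?_
      exact span_mono (Set.image_mono (Set.insert_subset_insert
        (Set.subset_biUnion_of_mem ht))) (hA t)
    refine span_le.2 ?_ (mkQ_mem_span_of_mem_span hM x₀ h1)
    rintro _ ⟨z, hz, rfl⟩
    obtain ⟨t, ht, hzt⟩ := Set.mem_iUnion₂.1 hz
    exact span_mono (by simpa using Set.mem_image_of_mem γ ht) (hAγ t z hzt)
  have star' : ∀ (T : Set V) u, u ∈ span K T → γ u ∈ span K' (γ '' T) := by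
    intro T u hu
    obtain h | ⟨y, hy, h⟩ := hγ u
    · rw [h]; exact zero_mem _
    · rw [h]
      refine star T y (span_le.2 ?_ hy)
      rintro _ (rfl | rfl)
      · exact span_mono (Set.subset_insert _ _) hu
      · exact subset_span (Set.mem_insert _ _)
  have hrep : RepresentsMorphism K K' γ := by
    refine ⟨fun c v => ?_, fun v w => ?_⟩
    · simpa using star' {v} (c • v) (Submodule.smul_mem _ _ (mem_span_singleton_self _))
    · have := star' {v, w} (v + w) (add_mem (subset_span (by simp)) (subset_span (by simp)))
      rwa [Set.image_pair] at this
  have hγr : ∀ y, span K' {π (f y)} = span K' {γ (r y)} := by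
    intro y
    apply le_antisymm <;> rw [span_singleton_le_iff_mem]
    · simpa using star {r y} y (subset_span (by simp))
    · obtain h | ⟨z, hz, h⟩ := hγ (r y)
      · rw [h]; exact zero_mem _
      · rw [h]
        have := mkQ_mem_span_of_mem_span hM x₀ (A := {y}) (y := z)
          (by rwa [Set.image_pair, Set.pair_comm])
        rwa [Set.image_singleton] at this
  have hind : LinearIndependent K' ![γ (r a), γ (r b), γ (r c)] := by
    refine linearIndependent_of_span_singleton_eq (fun i => ?_) habc
    fin_cases i
    exacts [hγr a, hγr b, hγr c]
  obtain ⟨F, hF⟩ := hrep.exists_addMonoidHom hind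
  have hind' : LinearIndependent K' ![F (r a), F (r b), F (r c)] := by
    refine linearIndependent_of_span_singleton_eq (fun i => ?_) hind
    fin_cases i
    exacts [(hF _).symm, (hF _).symm, (hF _).symm]
  refine ⟨F, ScalarCompatible.of_mem_span (a := r a) (b := r b) (fun l v => ?_) ?_,
    fun y => (hF _).trans (hγr y).symm⟩
  · rw [hF v, ← span_singleton_le_iff_mem, hF, span_singleton_le_iff_mem]
    exact hrep.smul_mem l v
  · have := linearIndependent_triple_iff.1 hind'
    refine LinearIndependent.pair_iff.2 fun s t h => ?_
    have := this s t 0 (by rw [zero_smul, add_zero, h])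
    exact ⟨this.1, this.2.1⟩

/-- With `N = N₁ + N₂` and `N₁ ∩ N₂ = 0`, the space `V'` is the fibre product of `V' ⧸ N₁` and `V' ⧸
N₂` over `V' ⧸ N`. The sum gives existence of the lift, and the trivial intersection gives its
uniqueness, hence additivity. -/
theorem exists_addMonoidHom_of_quotients {M : Type*} [AddGroup M] {N₁ N₂ N : Submodule K' V'}
    (h₁ : N₁ ≤ N) (h₂ : N₂ ≤ N) (hN : N ≤ N₁ ⊔ N₂) (hd : Disjoint N₁ N₂) (F₁ : M →+ V' ⧸ N₁)
    (F₂ : M →+ V' ⧸ N₂) (h : ∀ v, factor h₁ (F₁ v) = factor h₂ (F₂ v)) :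
    ∃ F : M →+ V', ∀ v, N₁.mkQ (F v) = F₁ v ∧ N₂.mkQ (F v) = F₂ v := by
  have hex : ∀ v, ∃ u : V', N₁.mkQ u = F₁ v ∧ N₂.mkQ u = F₂ v := by
    intro v
    obtain ⟨a, ha⟩ := N₁.mkQ_surjective (F₁ v)
    obtain ⟨b, hb⟩ := N₂.mkQ_surjective (F₂ v)
    have hv := h v
    rw [← ha, ← hb, factor_mk, factor_mk, mkQ_apply, mkQ_apply, Submodule.Quotient.eq] at hv
    obtain ⟨n, hn, m, hm, hnm⟩ := mem_sup.1 (hN hv)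
    refine ⟨a - n, ?_, ?_⟩
    · rw [map_sub, ha, mkQ_apply, (Submodule.Quotient.mk_eq_zero N₁).2 hn, sub_zero]
    · have : a - n = b + m := by rw [sub_eq_iff_eq_add, add_assoc, add_comm m, hnm]; abel
      rw [this, map_add, hb, mkQ_apply, (Submodule.Quotient.mk_eq_zero N₂).2 hm, add_zero]
  choose F hF₁ hF₂ using hex
  refine ⟨AddMonoidHom.mk' F fun v w => ?_, fun v => ⟨hF₁ v, hF₂ v⟩⟩
  rw [← sub_eq_zero]
  refine disjoint_def.1 hd _ ?_ ?_
  · rw [← Submodule.Quotient.mk_eq_zero, ← mkQ_apply]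
    simp only [map_sub, map_add, hF₁, sub_self]
  · rw [← Submodule.Quotient.mk_eq_zero, ← mkQ_apply]
    simp only [map_sub, map_add, hF₂, sub_self]

end Vectors

/-! ### Gluing the two projections, recovering the morphism, and uniqueness -/

section Vectors

open Submodule

variable {K V K' V' : Type*} [DivisionRing K] [AddCommGroup V] [Module K V]
    [DivisionRing K'] [AddCommGroup V'] [Module K' V'] {ι : Type*} {r : ι → V} {f : ι → V'}

theorem mkQ_eq_zero_iff {N : Submodule K V} {u : V} : N.mkQ u = 0 ↔ u ∈ N := by
  rw [mkQ_apply, Submodule.Quotient.mk_eq_zero]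

theorem mem_span_pair_of_mkQ_mem {u v w : V} (h : (span K {w}).mkQ u ∈ span K {(span K {w}).mkQ v}) :
    u ∈ span K {v, w} := by
  obtain ⟨c, hc⟩ := mem_span_singleton.1 h
  rw [← map_smul, eq_comm, ← sub_eq_zero, ← map_sub, mkQ_eq_zero_iff] at hc
  obtain ⟨d, hd⟩ := mem_span_singleton.1 hc
  exact mem_span_pair.2 ⟨c, d, by rw [hd]; abel⟩

theorem disjoint_span_singleton_of_pair {u v : V} (h : LinearIndependent K ![u, v]) :
    Disjoint (span K {u}) (span K {v}) := by
  rw [disjoint_def]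
  intro w hu hv
  obtain ⟨a, rfl⟩ := mem_span_singleton.1 hu
  obtain ⟨b, hb⟩ := mem_span_singleton.1 hv
  have := (LinearIndependent.pair_iff.1 h a (-b) (by rw [neg_smul, hb, add_neg_cancel])).1
  rw [this, zero_smul]

theorem linearIndependent_mkQ_triple {a b z w : V} (hab : LinearIndependent K ![a, b])
    (hzw : ∀ p q : K, p • z + q • w ∈ span K {a, b} → p = 0 ∧ q = 0) :
    LinearIndependent K ![(span K {a}).mkQ b, (span K {a}).mkQ z, (span K {a}).mkQ w] := by
  rw [linearIndependent_triple_iff]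
  intro s p q h
  simp only [← map_smul, ← map_add] at h
  rw [mkQ_eq_zero_iff] at h
  obtain ⟨c, hc⟩ := mem_span_singleton.1 h
  obtain ⟨rfl, rfl⟩ := hzw p q (mem_span_pair.2 ⟨c, -s, by rw [hc, neg_smul]; abel⟩)
  have := LinearIndependent.pair_iff.1 hab c (-s) (by
    rw [hc, zero_smul, zero_smul, neg_smul]; abel)
  exact ⟨neg_eq_zero.1 this.2, rfl, rfl⟩

/-- Additive maps compatible with scalars that agree, up to scalars, modulo two independent
vectors are glued to a single map. -/
theorem exists_glued_map {N₁ N₂ N : Submodule K' V'}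
    (h₁ : N₁ ≤ N) (h₂ : N₂ ≤ N) (hN : N ≤ N₁ ⊔ N₂) (hd : Disjoint N₁ N₂) (F₁ : V →+ V' ⧸ N₁)
    (F₂ : V →+ V' ⧸ N₂) (hF₁ : ScalarCompatible K K' F₁) (hF₂ : ScalarCompatible K K' F₂)
    (h : ∀ v, factor h₂ (F₂ v) ∈ span K' {factor h₁ (F₁ v)}) {a b : V}
    (hab : LinearIndependent K' ![factor h₁ (F₁ a), factor h₁ (F₁ b)])
    (ha : factor h₂ (F₂ a) ≠ 0) :
    ∃ F : V →+ V', ScalarCompatible K K' F ∧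
      ∀ v, span K' {N₁.mkQ (F v)} = span K' {F₁ v} ∧ span K' {N₂.mkQ (F v)} = span K' {F₂ v} := by
  obtain ⟨c, hc⟩ := AddMonoidHom.exists_smul_eq_of_mem_span
    ((factor h₁).toAddMonoidHom.comp F₁) ((factor h₂).toAddMonoidHom.comp F₂) h hab
  have hc' : ∀ v, factor h₂ (F₂ v) = c • factor h₁ (F₁ v) := hc
  have hc0 : c ≠ 0 := by
    rintro rfl
    exact ha (by rw [hc', zero_smul])
  obtain ⟨F, hF⟩ := exists_addMonoidHom_of_quotients h₁ h₂ hN hd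
    ((DistribSMul.toAddMonoidHom _ c).comp F₁) F₂ (fun v => by
      rw [hc', ← map_smul]; rfl)
  have hF1 : ∀ v, N₁.mkQ (F v) = c • F₁ v := fun v => (hF v).1
  have hF2 : ∀ v, N₂.mkQ (F v) = F₂ v := fun v => (hF v).2
  refine ⟨F, fun l => ?_, fun v => ⟨?_, by rw [hF2]⟩⟩
  · obtain ⟨d, hd₁⟩ := hF₁ l
    obtain ⟨e, hd₂⟩ := hF₂ l
    -- Over a noncommutative `K'`, rescaling by `c` conjugates the scalar `d` by which `F₁`
    -- transforms. The conjugate must be `e`, as seen modulo `N` at `a`.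
    have hde : c * d = e * c := by
      have h3 := hc' (l • a)
      rw [hd₁, hd₂, map_smul, map_smul, hc', smul_smul, smul_smul] at h3
      exact (smul_left_injective K' (hab.ne_zero 0) h3).symm
    refine ⟨e, fun v => ?_⟩
    rw [← sub_eq_zero]
    refine disjoint_def.1 hd _ ?_ ?_
    · rw [← mkQ_eq_zero_iff, map_sub, map_smul N₁.mkQ, hF1, hF1, hd₁, smul_smul, smul_smul, hde, sub_self]
    · rw [← mkQ_eq_zero_iff, map_sub, map_smul N₂.mkQ, hF2, hF2, hd₂, sub_self]
  · rw [hF1]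
    exact span_singleton_smul_eq (IsUnit.mk0 _ hc0) _

theorem exists_map_modulo (hM : ∀ (A : Set ι) y, r y ∈ span K (r '' A) → f y ∈ span K' (f '' A))
    {x₁ x₂ z w : ι} (h12 : LinearIndependent K' ![f x₁, f x₂])
    (hzw : ∀ p q : K', p • f z + q • f w ∈ span K' {f x₁, f x₂} → p = 0 ∧ q = 0)
    (hQ₁ : ∀ v ∉ span K {r x₁}, ∃ y, r y ∉ span K {r x₁} ∧ v ∈ span K {r y, r x₁})
    (hQ₂ : ∀ v ∉ span K {r x₂}, ∃ y, r y ∉ span K {r x₂} ∧ v ∈ span K {r y, r x₂}) :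
    ∃ F : V →+ V', ScalarCompatible K K' F ∧
      ∀ x, span K' {(span K' {f x₁}).mkQ (F (r x))} = span K' {(span K' {f x₁}).mkQ (f x)} ∧
        span K' {(span K' {f x₂}).mkQ (F (r x))} = span K' {(span K' {f x₂}).mkQ (f x)} := by
  have h21 : LinearIndependent K' ![f x₂, f x₁] := by
    rw [LinearIndependent.pair_iff] at h12 ⊢
    intro s t h
    rw [add_comm] at h
    exact (h12 t s h).symm
  obtain ⟨F₁, hc₁, hF₁⟩ := exists_pencil_map hM x₁ hQ₁ (linearIndependent_mkQ_triple h12 hzw)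
  obtain ⟨F₂, hc₂, hF₂⟩ := exists_pencil_map hM x₂ hQ₂
    (linearIndependent_mkQ_triple (z := f z) (w := f w) h21 (by rwa [Set.pair_comm]))
  set N := span K' {f x₁, f x₂} with hNdef
  have h₁ : span K' {f x₁} ≤ N := span_mono (by simp)
  have h₂ : span K' {f x₂} ≤ N := span_mono (by simp)
  have hN : N ≤ span K' {f x₁} ⊔ span K' {f x₂} := by rw [hNdef, span_insert]
  have hG₁ : ∀ x, span K' {factor h₁ (F₁ (r x))} = span K' {N.mkQ (f x)} := by
    intro x
    have := congrArg (map (factor h₁)) (hF₁ x)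
    rwa [map_span, map_span, Set.image_singleton, Set.image_singleton, factor_mk] at this
  have hG₂ : ∀ x, span K' {factor h₂ (F₂ (r x))} = span K' {N.mkQ (f x)} := by
    intro x
    have := congrArg (map (factor h₂)) (hF₂ x)
    rwa [map_span, map_span, Set.image_singleton, Set.image_singleton, factor_mk] at this
  have hfN : LinearIndependent K' ![N.mkQ (f z), N.mkQ (f w)] := by
    rw [LinearIndependent.pair_iff]
    intro p q h
    rw [← map_smul, ← map_smul, ← map_add, mkQ_eq_zero_iff] at h
    exact hzw p q h
  have hindep : LinearIndependent K' ![factor h₁ (F₁ (r z)), factor h₁ (F₁ (r w))] := by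
    refine linearIndependent_of_span_singleton_eq (fun i => ?_) hfN
    fin_cases i
    exacts [(hG₁ _).symm, (hG₁ _).symm]
  have hne : factor h₂ (F₂ (r z)) ≠ 0 := fun h =>
    hfN.ne_zero 0 ((eq_zero_iff_of_span_singleton_eq (hG₂ z)).1 h)
  have hx₁ : F₁ (r x₁) = 0 := (eq_zero_iff_of_span_singleton_eq (hF₁ x₁)).2
    (mkQ_eq_zero_iff.2 (mem_span_singleton_self _))
  have hx₂ : factor h₂ (F₂ (r x₁)) = 0 := (eq_zero_iff_of_span_singleton_eq (hG₂ x₁)).2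
    (mkQ_eq_zero_iff.2 (h₁ (mem_span_singleton_self _)))
  -- Modulo `N` both maps kill `r x₁` and represent `f` at every `r y`. Up to a multiple of `r x₁`,
  -- each `v` off that line is a nonzero multiple of some `r y`.
  have hmem : ∀ v, factor h₂ (F₂ v) ∈ span K' {factor h₁ (F₁ v)} := by
    intro v
    have hzero : ∀ b : K, factor h₂ (F₂ (b • r x₁)) = 0 := fun b => by
      obtain ⟨d, hd⟩ := hc₂ b
      rw [hd, map_smul, hx₂, smul_zero]
    have hzero' : ∀ b : K, F₁ (b • r x₁) = 0 := fun b => by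
      obtain ⟨d, hd⟩ := hc₁ b
      rw [hd, hx₁, smul_zero]
    by_cases hv : v ∈ span K {r x₁}
    · obtain ⟨b, rfl⟩ := mem_span_singleton.1 hv
      rw [hzero]
      exact zero_mem _
    obtain ⟨y, hy, hvy⟩ := hQ₁ v hv
    obtain ⟨a, b, rfl⟩ := mem_span_pair.1 hvy
    have ha : a ≠ 0 := by
      rintro rfl
      exact hv (by rw [zero_smul, zero_add]; exact smul_mem _ _ (mem_span_singleton_self _))
    rw [map_add, map_add, map_add, map_add, hzero, hzero', map_zero, add_zero, add_zero]
    have e1 : factor h₂ (F₂ (a • r y)) ∈ span K' {factor h₂ (F₂ (r y))} := by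
      obtain ⟨d, hd⟩ := hc₂ a
      rw [hd, map_smul]
      exact smul_mem _ _ (mem_span_singleton_self _)
    have e2 : factor h₁ (F₁ (r y)) ∈ span K' {factor h₁ (F₁ (a • r y))} := by
      have := mem_map_of_mem (f := factor h₁) (hc₁.mem_span_smul ha (r y))
      rwa [map_span, Set.image_singleton] at this
    rw [hG₂, ← hG₁] at e1
    exact (span_singleton_le_iff_mem _ _).2 e2 e1
  obtain ⟨F, hF, hFm⟩ := exists_glued_map h₁ h₂ hN (disjoint_span_singleton_of_pair h12) F₁ F₂
    hc₁ hc₂ hmem hindep hne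
  exact ⟨F, hF, fun x => ⟨(hFm _).1.trans (hF₁ x), (hFm _).2.trans (hF₂ x)⟩⟩

/-- The glued map is only controlled modulo `f x₁` and modulo `f x₂`, which does not determine
points inside `N`. Hypothesis `hE` expresses such a point through others, taken in the plane it
spans with `z` and `w`, whose images are off `N`. -/
theorem exists_semilinear_map (hr : ∀ x, r x ≠ 0) (hf : ∀ x, f x ≠ 0)
    (hM : ∀ (A : Set ι) y, r y ∈ span K (r '' A) → f y ∈ span K' (f '' A))
    {x₁ x₂ z w : ι} (h12 : LinearIndependent K' ![f x₁, f x₂])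
    (hzw : ∀ p q : K', p • f z + q • f w ∈ span K' {f x₁, f x₂} → p = 0 ∧ q = 0)
    (hQ₁ : ∀ v ∉ span K {r x₁}, ∃ y, r y ∉ span K {r x₁} ∧ v ∈ span K {r y, r x₁})
    (hQ₂ : ∀ v ∉ span K {r x₂}, ∃ y, r y ∉ span K {r x₂} ∧ v ∈ span K {r y, r x₂})
    (hE : ∀ x y z, LinearIndependent K ![r x, r y, r z] → ∃ B : Set ι,
      (∀ b ∈ B, r b ∈ span K {r x, r y, r z} ∧ r b ∉ span K {r x}) ∧ r x ∈ span K (r '' B)) :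
    ∃ (σ : K →+* K') (Φ : V →ₛₗ[σ] V'), ∀ x, span K' {Φ (r x)} = span K' {f x} := by
  obtain ⟨F, hFc, hF⟩ := exists_map_modulo hM h12 hzw hQ₁ hQ₂
  have hd := disjoint_span_singleton_of_pair h12
  have hne : ∀ x, F (r x) ≠ 0 := fun x h => hf x <| by
    have h1 := (eq_zero_iff_of_span_singleton_eq (hF x).1).1 (by rw [h, map_zero])
    have h2 := (eq_zero_iff_of_span_singleton_eq (hF x).2).1 (by rw [h, map_zero])
    exact disjoint_def.1 hd _ (mkQ_eq_zero_iff.1 h1) (mkQ_eq_zero_iff.1 h2)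
  obtain ⟨σ, Φ, hΦ⟩ := hFc.exists_ringHom (hne x₁)
  simp only [← hΦ] at hF hne
  refine ⟨σ, Φ, ?_⟩
  set N := span K' {f x₁, f x₂} with hN
  have m1 : ∀ x, Φ (r x) ∈ span K' {f x, f x₁} := fun x =>
    mem_span_pair_of_mkQ_mem ((hF x).1 ▸ mem_span_singleton_self _)
  have m2 : ∀ x, Φ (r x) ∈ span K' {f x, f x₂} := fun x =>
    mem_span_pair_of_mkQ_mem ((hF x).2 ▸ mem_span_singleton_self _)
  have n1 : f x₁ ∈ N := subset_span (by simp)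
  have n2 : f x₂ ∈ N := subset_span (by simp)
  have hoff : ∀ x, f x ∉ N → span K' {Φ (r x)} = span K' {f x} := by
    intro x hx
    obtain ⟨s, t, h1⟩ := mem_span_pair.1 (m1 x)
    obtain ⟨s', t', h2⟩ := mem_span_pair.1 (m2 x)
    -- The coefficient of `f x` is determined modulo `N`, because `f x` is not in `N`. The remaining
    -- terms then lie in both `⟨f x₁⟩` and `⟨f x₂⟩`, hence vanish.
    have hss : s = s' := by
      by_contra hss
      have : (s - s') • f x ∈ N := by
        have : (s - s') • f x = t' • f x₂ - t • f x₁ := by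
          rw [sub_smul, sub_eq_sub_iff_add_eq_add, h1, add_comm, h2]
        rw [this]
        exact sub_mem (smul_mem _ _ n2) (smul_mem _ _ n1)
      exact hx ((smul_mem_iff _ (sub_ne_zero.2 hss)).1 this)
    subst hss
    have ht : t • f x₁ = t' • f x₂ := add_left_cancel (h1.trans h2.symm)
    have ht0 : t • f x₁ = 0 := disjoint_def.1 hd _ (smul_mem _ _ (mem_span_singleton_self _))
      (ht ▸ smul_mem _ _ (mem_span_singleton_self _))
    rw [ht0, add_zero] at h1
    exact span_singleton_eq_of_mem (hne x) (mem_span_singleton.2 ⟨s, h1⟩)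
  intro x
  by_cases hx : f x ∈ N
  swap
  · exact hoff x hx
  have hzN : f z ∉ N := fun h => one_ne_zero (hzw 1 0 (by simpa using h)).1
  have hwN : f w ∉ N := fun h => one_ne_zero (hzw 0 1 (by simpa using h)).2
  have hΦx : Φ (r x) ∈ N := span_le.2 (by rintro _ (rfl | rfl); exacts [hx, n1]) (m1 x)
  have hΦzw : ∀ p q : K', p • Φ (r z) + q • Φ (r w) ∈ N → p = 0 ∧ q = 0 := by
    intro p q h
    obtain ⟨s, hs⟩ := mem_span_singleton.1 (hoff z hzN ▸ mem_span_singleton_self (Φ (r z)))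
    obtain ⟨t, ht⟩ := mem_span_singleton.1 (hoff w hwN ▸ mem_span_singleton_self (Φ (r w)))
    have hs0 : s ≠ 0 := by
      rintro rfl
      exact hne z (by rw [← hs, zero_smul])
    have ht0 : t ≠ 0 := by
      rintro rfl
      exact hne w (by rw [← ht, zero_smul])
    rw [← hs, ← ht, smul_smul, smul_smul] at h
    obtain ⟨h1, h2⟩ := hzw _ _ h
    exact ⟨(mul_eq_zero.1 h1).resolve_right hs0, (mul_eq_zero.1 h2).resolve_right ht0⟩
  -- A dependence among the source vectors would be carried by `hM` to the images, but `f z` and `f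
  -- w` are independent modulo `N` while `f x` is a nonzero vector of `N`.
  have hind : LinearIndependent K ![r x, r z, r w] := by
    refine linearIndependent_triple_of_notMem (hr w) (fun h => ?_) (fun h => ?_)
    · have := hM {w} z (by rwa [Set.image_singleton])
      rw [Set.image_singleton] at this
      obtain ⟨c, hc⟩ := mem_span_singleton.1 this
      exact one_ne_zero (hzw 1 (-c) (by simp [← hc])).1
    · have := hM {z, w} x (by rwa [Set.image_pair])
      rw [Set.image_pair] at this
      obtain ⟨p, q, hpq⟩ := mem_span_pair.1 this
      obtain ⟨rfl, rfl⟩ := hzw p q (hpq ▸ hx)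
      exact hf x (by rw [← hpq, zero_smul, zero_smul, add_zero])
  obtain ⟨B, hB, hxB⟩ := hE x z w hind
  have hfB : ∀ b ∈ B, f b ∈ span K' {Φ (r x), Φ (r z), Φ (r w)} := by
    intro b hb
    obtain ⟨hbs, hbx⟩ := hB b hb
    obtain ⟨a, c, d, habd⟩ := mem_span_triple.1 hbs
    have hΦb : Φ (r b) = σ a • Φ (r x) + σ c • Φ (r z) + σ d • Φ (r w) := by
      rw [← habd, map_add, map_add, map_smulₛₗ, map_smulₛₗ, map_smulₛₗ]
    -- Modulo `N` only the terms in `Φ (r z)` and `Φ (r w)` survive. Both coefficients vanish only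
    -- if `r b` is on `r x`, as `σ` is injective.
    have hbN : f b ∉ N := by
      intro hbN
      have h1 : Φ (r b) ∈ N := span_le.2 (by rintro _ (rfl | rfl); exacts [hbN, n1]) (m1 b)
      rw [hΦb, add_assoc] at h1
      obtain ⟨hc, hd⟩ := hΦzw _ _ ((N.add_mem_iff_right (smul_mem _ _ hΦx)).1 h1)
      rw [map_eq_zero] at hc hd
      refine hbx (mem_span_singleton.2 ⟨a, ?_⟩)
      rw [← habd, hc, hd, zero_smul, zero_smul, add_zero, add_zero]
    have : f b ∈ span K' {Φ (r b)} := hoff b hbN ▸ mem_span_singleton_self _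
    refine (span_singleton_le_iff_mem _ _).2 ?_ this
    exact mem_span_triple.2 ⟨_, _, _, hΦb.symm⟩
  have hfx : f x ∈ span K' {Φ (r x), Φ (r z), Φ (r w)} :=
    span_le.2 (by rintro _ ⟨b, hb, rfl⟩; exact hfB b hb) (hM B x hxB)
  -- As `f x` and `Φ (r x)` are in `N`, the coefficients of `Φ (r z)` and `Φ (r w)` vanish, leaving
  -- `f x` on `Φ (r x)`.
  obtain ⟨a, c, d, habd⟩ := mem_span_triple.1 hfx
  rw [← habd, add_assoc] at hx
  obtain ⟨rfl, rfl⟩ := hΦzw _ _ ((N.add_mem_iff_right (smul_mem _ _ hΦx)).1 hx)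
  rw [zero_smul, zero_smul, add_zero, add_zero] at habd
  exact (span_singleton_eq_of_mem (hf x) (mem_span_singleton.2 ⟨a, habd⟩)).symm

/-- Modulo `f x₁`, and likewise modulo `f x₂`, the two maps are pointwise proportional with two
independent values, so a single constant relates them. Equal constants leave a difference in `⟨f x₁⟩
∩ ⟨f x₂⟩ = 0`. -/
theorem semilinear_map_unique {x₁ x₂ z w : ι} (h12 : LinearIndependent K' ![f x₁, f x₂])
    (hzw : ∀ p q : K', p • f z + q • f w ∈ span K' {f x₁, f x₂} → p = 0 ∧ q = 0)
    (hQ₁ : ∀ v ∉ span K {r x₁}, ∃ y, r y ∉ span K {r x₁} ∧ v ∈ span K {r y, r x₁})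
    (hQ₂ : ∀ v ∉ span K {r x₂}, ∃ y, r y ∉ span K {r x₂} ∧ v ∈ span K {r y, r x₂})
    {σ σ' : K →+* K'} (Φ : V →ₛₗ[σ] V') (Φ' : V →ₛₗ[σ'] V')
    (hΦ : ∀ x, span K' {Φ (r x)} = span K' {f x}) (hΦ' : ∀ x, span K' {Φ' (r x)} = span K' {f x}) :
    ∃ c : K', c ≠ 0 ∧ ∀ v, Φ' v = c • Φ v := by
  have hd := disjoint_span_singleton_of_pair h12
  have modulo : ∀ x₀, (∀ v ∉ span K {r x₀}, ∃ y, r y ∉ span K {r x₀} ∧ v ∈ span K {r y, r x₀}) →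
      span K' {f x₀} ≤ span K' {f x₁, f x₂} →
      ∃ c : K', ∀ v, Φ' v - c • Φ v ∈ span K' {f x₀} := by
    intro x₀ hQ hle
    set π := (span K' {f x₀}).mkQ with hπ
    have e : ∀ x, span K' {π (Φ (r x))} = span K' {π (f x)} := fun x => by
      have := congrArg (map π) (hΦ x)
      rwa [map_span, map_span, Set.image_singleton, Set.image_singleton] at this
    have e' : ∀ x, span K' {π (Φ' (r x))} = span K' {π (f x)} := fun x => by
      have := congrArg (map π) (hΦ' x)
      rwa [map_span, map_span, Set.image_singleton, Set.image_singleton] at this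
    have hπ0 : π (f x₀) = 0 := mkQ_eq_zero_iff.2 (mem_span_singleton_self _)
    have z1 : π (Φ (r x₀)) = 0 := (eq_zero_iff_of_span_singleton_eq (e x₀)).2 hπ0
    have z2 : π (Φ' (r x₀)) = 0 := (eq_zero_iff_of_span_singleton_eq (e' x₀)).2 hπ0
    have hmem : ∀ v, π (Φ' v) ∈ span K' {π (Φ v)} := by
      intro v
      by_cases hv : v ∈ span K {r x₀}
      · obtain ⟨b, rfl⟩ := mem_span_singleton.1 hv
        rw [map_smulₛₗ Φ', map_smul π, z2, smul_zero]
        exact zero_mem _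
      obtain ⟨y, -, hvy⟩ := hQ v hv
      obtain ⟨a, b, rfl⟩ := mem_span_pair.1 hvy
      have ha : a ≠ 0 := by
        rintro rfl
        exact hv (by rw [zero_smul, zero_add]; exact smul_mem _ _ (mem_span_singleton_self _))
      simp only [map_add, map_smulₛₗ, RingHom.id_apply, z1, z2, smul_zero, add_zero]
      rw [span_singleton_smul_eq (IsUnit.mk0 _ ((map_ne_zero σ).2 ha)), e, ← e']
      exact smul_mem _ _ (mem_span_singleton_self _)
    have hindep : LinearIndependent K' ![π (Φ (r z)), π (Φ (r w))] := by
      have : LinearIndependent K' ![π (f z), π (f w)] := by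
        rw [LinearIndependent.pair_iff]
        intro p q h
        rw [← map_smul, ← map_smul, ← map_add, mkQ_eq_zero_iff] at h
        exact hzw p q (hle h)
      refine linearIndependent_of_span_singleton_eq (fun i => ?_) this
      fin_cases i
      exacts [(e z).symm, (e w).symm]
    obtain ⟨c, hc⟩ := AddMonoidHom.exists_smul_eq_of_mem_span
      (π.toAddMonoidHom.comp Φ.toAddMonoidHom) (π.toAddMonoidHom.comp Φ'.toAddMonoidHom) hmem hindep
    refine ⟨c, fun v => ?_⟩
    have hcv : π (Φ' v) = c • π (Φ v) := hc v
    rw [← mkQ_eq_zero_iff, map_sub, map_smul, ← hπ, hcv, sub_self]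
  have hle₁ : span K' {f x₁} ≤ span K' {f x₁, f x₂} := span_mono (by simp)
  have hle₂ : span K' {f x₂} ≤ span K' {f x₁, f x₂} := span_mono (by simp)
  obtain ⟨c, hc⟩ := modulo x₁ hQ₁ hle₁
  obtain ⟨d, hd'⟩ := modulo x₂ hQ₂ hle₂
  have hzN : f z ∉ span K' {f x₁, f x₂} := fun h =>
    one_ne_zero (hzw 1 0 (by simpa using h)).1
  have hΦz : Φ (r z) ∉ span K' {f x₁, f x₂} := by
    rw [← span_singleton_le_iff_mem, hΦ, span_singleton_le_iff_mem]
    exact hzN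
  -- At `r z` the two congruences put a multiple of `Φ (r z)`, by the difference of the constants,
  -- into `N`; but `Φ (r z)` is off `N`.
  have hcd : d = c := by
    by_contra hne
    have h1 := sub_mem (hle₁ (hc (r z))) (hle₂ (hd' (r z)))
    rw [sub_sub_sub_cancel_left, ← sub_smul] at h1
    exact hΦz ((smul_mem_iff _ (sub_ne_zero.2 hne)).1 h1)
  subst hcd
  have heq : ∀ v, Φ' v = d • Φ v := fun v =>
    sub_eq_zero.1 (disjoint_def.1 hd _ (hc v) (hd' v))
  refine ⟨d, ?_, heq⟩
  rintro rfl
  have h0 : Φ' (r z) = 0 := by rw [heq, zero_smul]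
  exact hzN ((eq_zero_iff_of_span_singleton_eq (hΦ' z)).1 h0 ▸ zero_mem _)

end Vectors

/-! ### Finite bases, and morphisms in terms of closures -/

namespace PointGeometry

variable {X : Type u} {Y : Type v}

theorem exists_isBasis_subset (G : PointGeometry X) {A : Set X} (hA : A.Finite) :
    ∃ B ⊆ A, G.IsBasis B (G.closure A) := by
  induction h : A.ncard using Nat.strong_induction_on generalizing A with
  | _ n ih =>
    by_cases hi : G.Independent A
    · exact ⟨A, subset_rfl, hi, rfl⟩
    · unfold Independent at hi
      push Not at hi
      obtain ⟨a, ha, hac⟩ := hi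
      obtain ⟨B, hBA, hB, hBc⟩ := ih _ (h ▸ Set.ncard_sdiff_singleton_lt_of_mem ha hA)
        (hA.subset Set.sdiff_subset) rfl
      refine ⟨B, hBA.trans Set.sdiff_subset, hB, hBc.trans ?_⟩
      refine (G.closure_mono Set.sdiff_subset).antisymm (G.closure_subset (G.closure_mem _) ?_)
      intro b hb
      by_cases hba : b = a
      · exact hba ▸ hac
      · exact G.subset_closure _ ⟨hb, hba⟩

theorem IsMorphism.mem_closure_image {G : PointGeometry X} {H : PointGeometry Y} {φ : X → Y}
    (hφ : G.IsMorphism H φ) {A : Set X} {y : X} (hy : y ∈ G.closure A) :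
    φ y ∈ H.closure (φ '' A) :=
  G.closure_subset (hφ _ (H.closure_mem (φ '' A)))
    (fun a ha => H.subset_closure _ ⟨a, ha, rfl⟩) hy

end PointGeometry

/-! ### Translation of the geometric hypotheses into linear algebra -/

section Projective

open Submodule

variable {K V K' V' : Type*} [DivisionRing K] [AddCommGroup V] [Module K V]
    [DivisionRing K'] [AddCommGroup V'] [Module K' V']

theorem Projectivization.eq_of_rep_mem_span {p q : ℙ K V} (h : p.rep ∈ span K {q.rep}) : p = q := by
  obtain ⟨c, hc⟩ := mem_span_singleton.1 h
  rw [← p.mk_rep, ← q.mk_rep, Projectivization.mk_eq_mk_iff']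
  exact ⟨c, hc⟩

theorem mem_closure_projectiveGeometry {A : Set (ℙ K V)} {p : ℙ K V} :
    p ∈ (projectiveGeometry K V).closure A ↔ p.rep ∈ span K (Projectivization.rep '' A) :=
  mem_familyClosure_projectiveFlats K V A p

theorem mem_closure_subgeometry {X : Set (ℙ K V)} {A : Set X} {x : X} :
    x ∈ ((projectiveGeometry K V).subgeometry X).closure A ↔
      (x : ℙ K V).rep ∈ span K ((fun y : X => (y : ℙ K V).rep) '' A) := by
  change x ∈ familyClosure ((projectiveGeometry K V).traceFlats X) A ↔ _
  rw [PointGeometry.familyClosure_traceFlats, Set.mem_ofPred_eq, mem_closure_projectiveGeometry,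
    ← Set.image_comp]
  rfl

variable {X : Set (ℙ K V)}

theorem isLine_closure_pair {a b : X} (hab : a ≠ b) :
    ((projectiveGeometry K V).subgeometry X).IsLine
      (((projectiveGeometry K V).subgeometry X).closure {a, b}) := by
  refine ⟨{a, b}, ⟨?_, rfl⟩, by rw [Set.encard_pair hab]; norm_num⟩
  have key : ∀ a b : X, a ≠ b →
      a ∉ ((projectiveGeometry K V).subgeometry X).closure ({a, b} \ {a}) := by
    intro a b hab h
    have h1 := PointGeometry.closure_mono _
      (show ({a, b} \ {a} : Set X) ⊆ {b} by simp) h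
    rw [mem_closure_subgeometry, Set.image_singleton] at h1
    exact hab (Subtype.ext (Projectivization.eq_of_rep_mem_span h1))
  rintro c (rfl | rfl)
  · exact key _ _ hab
  · rw [Set.pair_comm]
    exact key _ _ hab.symm

theorem isPlane_closure_triple {x y z : X}
    (h : LinearIndependent K ![(x : ℙ K V).rep, (y : ℙ K V).rep, (z : ℙ K V).rep]) :
    ((projectiveGeometry K V).subgeometry X).IsPlane
      (((projectiveGeometry K V).subgeometry X).closure {x, y, z}) := by
  rw [linearIndependent_triple_iff] at h
  have hx : (x : ℙ K V).rep ∉ span K {(y : ℙ K V).rep, (z : ℙ K V).rep} := by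
    intro hm
    obtain ⟨s, t, hst⟩ := mem_span_pair.1 hm
    exact one_ne_zero (h 1 (-s) (-t) (by rw [← hst]; simp only [one_smul, neg_smul]; abel)).1
  have hy : (y : ℙ K V).rep ∉ span K {(x : ℙ K V).rep, (z : ℙ K V).rep} := by
    intro hm
    obtain ⟨s, t, hst⟩ := mem_span_pair.1 hm
    exact one_ne_zero (h (-s) 1 (-t) (by rw [← hst]; simp only [one_smul, neg_smul]; abel)).2.1
  have hz : (z : ℙ K V).rep ∉ span K {(x : ℙ K V).rep, (y : ℙ K V).rep} := by
    intro hm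
    obtain ⟨s, t, hst⟩ := mem_span_pair.1 hm
    exact one_ne_zero (h (-s) (-t) 1 (by rw [← hst]; simp only [one_smul, neg_smul]; abel)).2.2
  have key : ∀ a b c : X, (a : ℙ K V).rep ∉ span K {(b : ℙ K V).rep, (c : ℙ K V).rep} →
      ∀ A : Set X, A ⊆ {a, b, c} →
      a ∉ ((projectiveGeometry K V).subgeometry X).closure (A \ {a}) := by
    intro a b c hab A hA hm
    have h1 := PointGeometry.closure_mono _ (show A \ {a} ⊆ {b, c} by
      rintro u ⟨hu, hua⟩
      exact (hA hu).resolve_left hua) hm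
    rw [mem_closure_subgeometry, Set.image_pair] at h1
    exact hab h1
  refine ⟨{x, y, z}, ⟨?_, rfl⟩, ?_⟩
  · rintro a (rfl | rfl | rfl)
    · exact key _ _ _ hx _ subset_rfl
    · exact key _ _ _ hy _ (by rw [Set.insert_comm])
    · refine key _ _ _ hz _ ?_
      rw [Set.pair_comm y, Set.insert_comm, Set.pair_comm x]
  · rw [Set.encard_eq_three.2 ⟨x, y, z, ?_, ?_, ?_, rfl⟩]
    · norm_num
    · rintro rfl
      exact hx (subset_span (by simp))
    · rintro rfl
      exact hx (subset_span (by simp))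
    · rintro rfl
      exact hy (subset_span (by simp))

theorem linearIndependent_of_not_collinear {a b c : X} (hbc : b ≠ c)
    (h : ¬ ((projectiveGeometry K V).subgeometry X).Collinear {a, b, c}) :
    LinearIndependent K ![(a : ℙ K V).rep, (b : ℙ K V).rep, (c : ℙ K V).rep] := by
  refine linearIndependent_triple_of_notMem (Projectivization.rep_nonzero _)
    (fun hm => hbc (Subtype.ext (Projectivization.eq_of_rep_mem_span hm))) fun hm => h ?_
  refine ⟨_, isLine_closure_pair hbc, Set.insert_subset ?_ (PointGeometry.subset_closure _ _)⟩
  rwa [mem_closure_subgeometry, Set.image_pair]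

/-- Removing `x` from the four points of the plane leaves three noncollinear ones, which span the
plane and in particular `x`. -/
theorem PointGeometry.EnoughPoints.exists_spanning
    (hX : ((projectiveGeometry K V).subgeometry X).EnoughPoints) {x y z : X}
    (h : LinearIndependent K ![(x : ℙ K V).rep, (y : ℙ K V).rep, (z : ℙ K V).rep]) :
    ∃ B : Set X, (∀ b ∈ B,
        (b : ℙ K V).rep ∈ span K {(x : ℙ K V).rep, (y : ℙ K V).rep, (z : ℙ K V).rep} ∧
        (b : ℙ K V).rep ∉ span K {(x : ℙ K V).rep}) ∧
      (x : ℙ K V).rep ∈ span K ((fun b : X => (b : ℙ K V).rep) '' B) := by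
  obtain ⟨Q, hQ, hcard, hcol⟩ := hX.2 _ (isPlane_closure_triple h)
  have hQs : ∀ b ∈ Q,
      (b : ℙ K V).rep ∈ span K {(x : ℙ K V).rep, (y : ℙ K V).rep, (z : ℙ K V).rep} := by
    intro b hb
    have := hQ hb
    rwa [mem_closure_subgeometry, Set.image_insert_eq, Set.image_pair] at this
  refine ⟨Q \ {x}, fun b hb => ⟨hQs b hb.1, fun hm =>
    hb.2 (Subtype.ext (Projectivization.eq_of_rep_mem_span hm))⟩, ?_⟩
  -- Three points remain whether or not `x` is one of the four.
  have h3 : (3 : ℕ∞) ≤ (Q \ {x}).encard := by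
    have h1 := Set.encard_tsub_one_le_encard_sdiff_singleton Q x
    rw [hcard] at h1
    exact h1
  obtain ⟨T, hT, hT3⟩ := Set.exists_subset_encard_eq h3
  obtain ⟨a, b, c, -, -, hbc, rfl⟩ := Set.encard_eq_three.1 hT3
  have hind := linearIndependent_of_not_collinear hbc
    (hcol _ (hT.trans Set.sdiff_subset) hT3)
  have hle : span K (Set.range ![(a : ℙ K V).rep, (b : ℙ K V).rep, (c : ℙ K V).rep]) ≤
      span K (Set.range ![(x : ℙ K V).rep, (y : ℙ K V).rep, (z : ℙ K V).rep]) := by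
    refine span_le.2 ?_
    rintro _ ⟨i, rfl⟩
    have hr : Set.range ![(x : ℙ K V).rep, (y : ℙ K V).rep, (z : ℙ K V).rep] =
        {(x : ℙ K V).rep, (y : ℙ K V).rep, (z : ℙ K V).rep} := by
      rw [Matrix.range_cons, Matrix.range_cons_cons_empty, Set.singleton_union]
    rw [hr]
    fin_cases i
    · exact hQs a (hT (by simp)).1
    · exact hQs b (hT (by simp)).1
    · exact hQs c (hT (by simp)).1
  have : FiniteDimensional K
      (span K (Set.range ![(x : ℙ K V).rep, (y : ℙ K V).rep, (z : ℙ K V).rep])) :=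
    FiniteDimensional.span_of_finite K (Set.finite_range _)
  have heq := eq_of_le_of_finrank_eq hle (by
    rw [finrank_span_eq_card hind, finrank_span_eq_card h])
  have hx : (x : ℙ K V).rep ∈
      span K (Set.range ![(a : ℙ K V).rep, (b : ℙ K V).rep, (c : ℙ K V).rep]) :=
    heq ▸ subset_span ⟨0, rfl⟩
  refine span_mono ?_ hx
  rintro _ ⟨i, rfl⟩
  fin_cases i
  exacts [⟨a, hT (by simp), rfl⟩, ⟨b, hT (by simp), rfl⟩, ⟨c, hT (by simp), rfl⟩]

/-- The class of `⟨v⟩` in the quotient by `x` is reached by some `y` in `X`, so `y` and `⟨v⟩` span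
the same line with `x`. -/
theorem PointGeometry.QuotientsAgree.exists_mem_span {x : X}
    (h : (projectiveGeometry K V).QuotientsAgree X x) (v : V)
    (hv : v ∉ span K {(x : ℙ K V).rep}) :
    ∃ y : X, (y : ℙ K V).rep ∉ span K {(x : ℙ K V).rep} ∧
      v ∈ span K {(y : ℙ K V).rep, (x : ℙ K V).rep} := by
  have hv0 : v ≠ 0 := by
    rintro rfl
    exact hv (zero_mem _)
  have hp : v ∈ span K {(Projectivization.mk K v hv0).rep} := by
    obtain ⟨c, hc⟩ := Projectivization.exists_smul_eq_mk_rep K v hv0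
    exact mem_span_singleton_symm (Projectivization.rep_nonzero _)
      (mem_span_singleton.2 ⟨c, hc⟩)
  have hpx : Projectivization.mk K v hv0 ∉ ({(x : ℙ K V)} : Set (ℙ K V)) := by
    intro he
    rw [Set.mem_singleton_iff.1 he] at hp
    exact hv hp
  obtain ⟨q, hq⟩ := h (Quotient.mk _ ⟨_, hpx⟩)
  induction q using Quotient.inductionOn with
  | h y =>
    obtain ⟨y, hy⟩ := y
    have he : (projectiveGeometry K V).closure {(y : ℙ K V), (x : ℙ K V)} =
        (projectiveGeometry K V).closure {Projectivization.mk K v hv0, (x : ℙ K V)} :=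
      Quotient.exact hq
    refine ⟨y, fun hm => hy (Subtype.ext (Projectivization.eq_of_rep_mem_span hm)), ?_⟩
    have hm : Projectivization.mk K v hv0 ∈
        (projectiveGeometry K V).closure {(y : ℙ K V), (x : ℙ K V)} :=
      he ▸ PointGeometry.subset_closure _ _ (Set.mem_insert _ _)
    rw [mem_closure_projectiveGeometry, Set.image_pair] at hm
    exact (span_singleton_le_iff_mem _ _).2 hm hp

theorem PointGeometry.IsMorphism.rep_mem_span {φ : X → ℙ K' V'}
    (hφ : ((projectiveGeometry K V).subgeometry X).IsMorphism (projectiveGeometry K' V') φ)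
    (A : Set X) (y : X)
    (hy : (y : ℙ K V).rep ∈ span K ((fun x : X => (x : ℙ K V).rep) '' A)) :
    (φ y).rep ∈ span K' ((fun x => (φ x).rep) '' A) := by
  have := hφ.mem_closure_image (mem_closure_subgeometry.2 hy)
  rwa [mem_closure_projectiveGeometry, ← Set.image_comp] at this

theorem exists_rep_notMem_span {ι : Type*} {φ : ι → ℙ K' V'}
    (himage : ¬ ∃ S : Set (ℙ K' V'), (projectiveGeometry K' V').DimLE S 2 ∧ Set.range φ ⊆ S)
    (p q s : ℙ K' V') : ∃ w, (φ w).rep ∉ span K' {p.rep, q.rep, s.rep} := by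
  by_contra! h
  obtain ⟨B, hB, hBb⟩ := (projectiveGeometry K' V').exists_isBasis_subset
    (A := {p, q, s}) (Set.toFinite _)
  refine himage ⟨_, ⟨B, hBb, (Set.encard_le_encard hB).trans ?_⟩, ?_⟩
  · calc ({p, q, s} : Set (ℙ K' V')).encard ≤ ({q, s} : Set (ℙ K' V')).encard + 1 :=
          Set.encard_insert_le _ _
      _ ≤ ((2 : ℕ) : ℕ∞) + 1 := by
        gcongr
        exact (Set.encard_insert_le _ _).trans (by rw [Set.encard_singleton]; norm_num)
  · rintro _ ⟨w, rfl⟩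
    rw [mem_closure_projectiveGeometry, Set.image_insert_eq, Set.image_pair]
    exact h w

/-- This is where the dimension of the image enters: a first value off the line through `p` and `q`,
then a second off the plane so obtained, are independent modulo the line. -/
theorem exists_independent_pair {ι : Type*} {φ : ι → ℙ K' V'}
    (himage : ¬ ∃ S : Set (ℙ K' V'), (projectiveGeometry K' V').DimLE S 2 ∧ Set.range φ ⊆ S)
    (p q : ℙ K' V') : ∃ z w, ∀ a b : K', a • (φ z).rep + b • (φ w).rep ∈ span K' {p.rep, q.rep} →
      a = 0 ∧ b = 0 := by
  -- The repeated `p` specialises the statement about planes to the span of `p` and `q`.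
  obtain ⟨z, hz⟩ := exists_rep_notMem_span himage p p q
  obtain ⟨w, hw⟩ := exists_rep_notMem_span himage (φ z) p q
  rw [Set.insert_eq_of_mem (Set.mem_insert _ _)] at hz
  refine ⟨z, w, fun a b h => ?_⟩
  have hb : b = 0 := by
    by_contra hb
    refine hw ((smul_mem_iff _ hb).1 ?_)
    have h1 := span_mono (Set.subset_insert (φ z).rep _) h
    exact (Submodule.add_mem_iff_right _ (smul_mem _ _ (subset_span (Set.mem_insert _ _)))).1 h1
  subst hb
  rw [zero_smul, add_zero] at h
  exact ⟨by_contra fun ha => hz ((smul_mem_iff _ ha).1 h), rfl⟩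

theorem linearIndependent_rep_pair {p q : ℙ K V} (h : p ≠ q) :
    LinearIndependent K ![p.rep, q.rep] := by
  rw [LinearIndependent.pair_iff' p.rep_nonzero]
  intro c hc
  exact h (Projectivization.eq_of_rep_mem_span (mem_span_singleton.2 ⟨c, hc⟩)).symm

theorem isRestrictionOf_partialProjectivization_iff {φ : X → ℙ K' V'} {σ : K →+* K'}
    {Φ : V →ₛₗ[σ] V'} : IsRestrictionOf φ (partialProjectivization Φ) ↔
      ∀ x : X, span K' {Φ (x : ℙ K V).rep} = span K' {(φ x).rep} := by
  refine forall_congr' fun x => ?_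
  have h := mem_partialProjectivization_mk Φ (x : ℙ K V).rep (x : ℙ K V).rep_nonzero (φ x)
  rw [Projectivization.mk_rep] at h
  rw [h]
  constructor
  · rintro ⟨h0, hx⟩
    rw [← Projectivization.submodule_mk _ h0, hx, Projectivization.submodule_eq]
  · intro hx
    have h0 : Φ (x : ℙ K V).rep ≠ 0 := fun h0 =>
      (φ x).rep_nonzero ((eq_zero_iff_of_span_singleton_eq hx).1 h0)
    refine ⟨h0, Projectivization.submodule_injective ?_⟩
    rw [Projectivization.submodule_mk, hx, Projectivization.submodule_eq]

theorem partialProjectivization_eq_of_smul {σ σ' : K →+* K'} {Φ : V →ₛₗ[σ] V'} {Φ' : V →ₛₗ[σ'] V'}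
    {c : K'} (hc : c ≠ 0) (h : ∀ v, Φ' v = c • Φ v) :
    partialProjectivization Φ' = partialProjectivization Φ := by
  funext p
  induction p using Projectivization.ind with
  | h v hv =>
    refine Part.ext fun q => ?_
    rw [mem_partialProjectivization_mk, mem_partialProjectivization_mk]
    have hne : Φ' v ≠ 0 ↔ Φ v ≠ 0 := by rw [h, smul_ne_zero_iff]; exact and_iff_right hc
    have heq : ∀ (h1 : Φ' v ≠ 0) (h2 : Φ v ≠ 0),
        Projectivization.mk K' (Φ' v) h1 = Projectivization.mk K' (Φ v) h2 := fun h1 h2 =>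
      (Projectivization.mk_eq_mk_iff' K' _ _ h1 h2).2 ⟨c, (h v).symm⟩
    exact ⟨fun ⟨h1, hq⟩ => ⟨hne.1 h1, (heq h1 _) ▸ hq⟩, fun ⟨h2, hq⟩ =>
      ⟨hne.2 h2, (heq _ h2).trans hq⟩⟩

end Projective

/-! ### The main theorem -/

theorem theorem2p6 {K V K' V' : Type*} [DivisionRing K] [AddCommGroup V] [Module K V]
    [DivisionRing K'] [AddCommGroup V'] [Module K' V']
    (X : Set (ℙ K V)) (hX : ((projectiveGeometry K V).subgeometry X).EnoughPoints)
    (φ : X → ℙ K' V')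
    (hφ : ((projectiveGeometry K V).subgeometry X).IsMorphism (projectiveGeometry K' V') φ)
    (himage : ¬ ∃ S : Set (ℙ K' V'), (projectiveGeometry K' V').DimLE S 2 ∧ Set.range φ ⊆ S)
    (hpts : ∃ x₁ x₂ : X, (projectiveGeometry K V).QuotientsAgree X x₁ ∧
      (projectiveGeometry K V).QuotientsAgree X x₂ ∧ φ x₁ ≠ φ x₂) :
    (∃! ϕ : ℙ K V →. ℙ K' V', IsPartialProjectiveMorphism ϕ ∧ IsRestrictionOf φ ϕ) ∧
    ∃ (σ : K →+* K') (Φ : V →ₛₗ[σ] V'), IsRestrictionOf φ (partialProjectivization Φ) ∧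
      ∀ (σ' : K →+* K') (Φ' : V →ₛₗ[σ'] V'), IsRestrictionOf φ (partialProjectivization Φ') →
        ∃ c : K', c ≠ 0 ∧ ∀ v : V, Φ' v = c • Φ v := by
  obtain ⟨x₁, x₂, hx₁, hx₂, hne⟩ := hpts
  obtain ⟨z, w, hzw⟩ := exists_independent_pair himage (φ x₁) (φ x₂)
  have h12 := linearIndependent_rep_pair hne
  obtain ⟨σ, Φ, hΦ⟩ := exists_semilinear_map (r := fun x : X => (x : ℙ K V).rep)
    (f := fun x => (φ x).rep) (fun x => Projectivization.rep_nonzero _)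
    (fun x => Projectivization.rep_nonzero _) hφ.rep_mem_span h12 hzw hx₁.exists_mem_span
    hx₂.exists_mem_span (fun x y z h => hX.exists_spanning h)
  have huniq : ∀ (σ' : K →+* K') (Φ' : V →ₛₗ[σ'] V'),
      IsRestrictionOf φ (partialProjectivization Φ') → ∃ c : K', c ≠ 0 ∧ ∀ v : V, Φ' v = c • Φ v :=
    fun σ' Φ' h => semilinear_map_unique (r := fun x : X => (x : ℙ K V).rep)
      (f := fun x => (φ x).rep) h12 hzw hx₁.exists_mem_span hx₂.exists_mem_span Φ Φ' hΦ
      (isRestrictionOf_partialProjectivization_iff.1 h)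
  have hres := isRestrictionOf_partialProjectivization_iff.2 hΦ
  refine ⟨⟨_, ⟨⟨σ, Φ, rfl⟩, hres⟩, ?_⟩, σ, Φ, hres, huniq⟩
  rintro _ ⟨⟨σ', Φ', rfl⟩, h'⟩
  obtain ⟨c, hc, h⟩ := huniq σ' Φ' h'
  exact partialProjectivization_eq_of_smul hc h
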